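/- **Theorem 1.1.** Give $\mathrm{Sym}(\omega)$ the topology of pointwise convergence, and give the set of all closed subgroups of $\mathrm{Sym}(\omega)$ the (Effros) Borel structure generated by the sets $\{G : G\cap U\neq\emptyset\}$, $U\subseteq \mathrm{Sym}(\omega)$ open. A closed subgroup $G$ is *oligomorphic* if for every $n<\omega$ it has only finitely many orbits on $\omega^n$. A structure $M$ with domain $\omega$ in a countable first-order language is *$\omega$-categorical* if every countably infinite model of its first-order theory is isomorphic to $M$. For $G=\mathrm{Aut}(M)$ and $A\subseteq\omega$ write $G_{(A)}$ and $G_{\{A\}}$ for the pointwise and the setwise stabilizer of $A$ in $G$; $A$ is *algebraically closed* if it contains every point whose orbit under $G_{(A)}$ is finite. $M$ has *weak elimination of imaginaries* if for every subgroup $H\le G$ which contains $G_{(C)}$ for some finite $C\subseteq\omega$ there is a (necessarily unique) smallest finite algebraically closed set $K\subseteq\omega$ with $G_{(K)}\le H\le G_{\{K\}}$. Let $\mathcal W$ be the set of the closed subgroups of $\mathrm{Sym}(\omega)$ of the form $\mathrm{Aut}(M)$, where $M$ is an $\omega$-categorical structure with domain $\omega$, in a countable language, with weak elimination of imaginaries.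 Then the oligomorphic groups form a Borel set of closed subgroups, $\mathcal W$ is a Borel set of oligomorphic groups, and the relation of topological isomorphism (isomorphism by a group isomorphism that is also a homeomorphism) on $\mathcal W$ is smooth: there is a Borel map $f:\mathcal W\to\mathbb R$ such that, for all $G,H\in\mathcal W$, $G$ and $H$ are topologically isomorphic if and only if $f(G)=f(H)$. -/

import Mathlib

open scoped Pointwise

noncomputable section

namespace OligoIso

/-- The topology of pointwise convergence on `Sym(ω)`, for `ω` discrete: the pointwise stabilizers
of the finite subsets of `ω` form a neighbourhood basis of the identity. -/
instance symTopology : TopologicalSpace (Equiv.Perm ℕ) :=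
  TopologicalSpace.induced (fun (σ : Equiv.Perm ℕ) (n : ℕ) => σ n) inferInstance

/-- The Effros Borel structure on the closed subgroups of `Sym(ω)`: it is generated by the sets
`{G | G ∩ U ≠ ∅}` with `U` open. -/
instance effrosBorel : MeasurableSpace (ClosedSubgroup (Equiv.Perm ℕ)) :=
  MeasurableSpace.generateFrom
    {S | ∃ U : Set (Equiv.Perm ℕ), IsOpen U ∧
      S = {G : ClosedSubgroup (Equiv.Perm ℕ) | ((G : Set (Equiv.Perm ℕ)) ∩ U).Nonempty}}

/-- Finitely many orbits on `n`-tuples, for every `n`. -/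
def IsOligomorphic (G : Subgroup (Equiv.Perm ℕ)) : Prop :=
  ∀ n : ℕ, Finite (MulAction.orbitRel.Quotient G (Fin n → ℕ))

/-- The pointwise stabilizer `G_(A)`. -/
def ptStab (G : Subgroup (Equiv.Perm ℕ)) (A : Set ℕ) : Subgroup (Equiv.Perm ℕ) :=
  G ⊓ fixingSubgroup (Equiv.Perm ℕ) A

/-- The setwise stabilizer `G_{A}`, that is, `{g ∈ G | g '' A = A}`. -/
def setStab (G : Subgroup (Equiv.Perm ℕ)) (A : Set ℕ) : Subgroup (Equiv.Perm ℕ) :=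
  G ⊓ MulAction.stabilizer (Equiv.Perm ℕ) A

/-- The algebraic closure of `A`: the points whose orbit under `G_(A)` is finite. -/
def acl (G : Subgroup (Equiv.Perm ℕ)) (A : Set ℕ) : Set ℕ :=
  {a | (MulAction.orbit (ptStab G A) a).Finite}

/-- Weak elimination of imaginaries, for a structure with automorphism group `G`: for every
subgroup `H` of `G` that contains the pointwise stabilizer of a finite set there is a (unique)
smallest finite algebraically closed set `K` with `G_(K) ≤ H ≤ G_{K}`. -/
def WeakEI (G : Subgroup (Equiv.Perm ℕ)) : Prop :=
  ∀ H : Subgroup (Equiv.Perm ℕ), H ≤ G → (∃ C : Set ℕ, C.Finite ∧ ptStab G C ≤ H) →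
    ∃ K : Set ℕ, IsLeast
      {K : Set ℕ | K.Finite ∧ acl G K = K ∧ ptStab G K ≤ H ∧ H ≤ setStab G K} K

/-- The automorphism group of a first-order structure with domain `ω`. -/
def autGroup (L : FirstOrder.Language.{0, 0}) [L.Structure ℕ] : Subgroup (Equiv.Perm ℕ) where
  carrier := {σ | ∃ e : L.Equiv ℕ ℕ, e.toEquiv = σ}
  mul_mem' := by
    rintro _ _ ⟨e, rfl⟩ ⟨f, rfl⟩
    exact ⟨e.comp f, rfl⟩
  one_mem' := ⟨FirstOrder.Language.Equiv.refl L ℕ, rfl⟩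
  inv_mem' := by
    rintro _ ⟨e, rfl⟩
    exact ⟨e.symm, rfl⟩

/-- A structure with domain `ω` is `ω`-categorical: its first-order theory has, up to isomorphism,
exactly one countably infinite model. -/
def OmegaCategorical (L : FirstOrder.Language.{0, 0}) [L.Structure ℕ] : Prop :=
  Cardinal.Categorical Cardinal.aleph0.{0} (L.completeTheory ℕ)

/-- The closed subgroups of `Sym(ω)` that are the automorphism group of some `ω`-categorical
structure, in a countable language and with domain `ω`, with weak elimination of imaginaries. -/
def autOmegaCatWEI : Set (ClosedSubgroup (Equiv.Perm ℕ)) :=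
  {G | ∃ (L : FirstOrder.Language.{0, 0}) (_ : Countable L.Symbols) (_ : L.Structure ℕ),
    OmegaCategorical L ∧ WeakEI (autGroup L) ∧ autGroup L = G.toSubgroup}

/-- The oligomorphic closed subgroups of `Sym(ω)`. -/
def oligomorphicGroups : Set (ClosedSubgroup (Equiv.Perm ℕ)) :=
  {G | IsOligomorphic G.toSubgroup}

/-- Topological isomorphism: an isomorphism of groups that is a homeomorphism, for the subspace
topologies. -/
def TopIso (G H : ClosedSubgroup (Equiv.Perm ℕ)) : Prop :=
  Nonempty (G.toSubgroup ≃ₜ* H.toSubgroup)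

/-- Borel reducibility of a relation `E` on `X` to a relation `F` on `Y`. -/
def BorelReducible {X Y : Type*} [MeasurableSpace X] [MeasurableSpace Y]
    (E : X → X → Prop) (F : Y → Y → Prop) : Prop :=
  ∃ f : X → Y, Measurable f ∧ ∀ x₁ x₂ : X, E x₁ x₂ ↔ F (f x₁) (f x₂)

/-- Smoothness: Borel reducibility to equality on the reals. -/
def Smooth {X : Type*} [MeasurableSpace X] (E : X → X → Prop) : Prop :=
  BorelReducible E (fun r s : ℝ => r = s)

end OligoIso

end

/-!
A closed oligomorphic group `G` is the automorphism group of the structure with a relation for each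
orbit on tuples, which is `ω`-categorical; conversely the automorphism group of an `ω`-categorical
structure in a countable language is oligomorphic (the Ryll-Nardzewski theorem:
`isOligomorphic_of_omegaCategorical`, `omegaCategorical_of_isOligomorphic`). Hence the set in
question consists of the oligomorphic closed subgroups with weak elimination of imaginaries
(`autOmegaCatWEI_eq`). Both conditions are Borel. A quantifier over the members of `G` ranges in
effect over a countable set as soon as its scope depends on finitely many values
(`measurableSet_exists_mem`), and, for `G` oligomorphic, a subgroup that contains the stabilizer of
a finite set consists of finitely many double cosets, so that weak elimination of imaginaries
quantifies over finite data only (`weakEI_iff`).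

The invariant comes from the cosets of the pointwise stabilizers `G_(K)` of the finite algebraically
closed sets `K`, which correspond to the restrictions `g|K` with `g ∈ G`. They form a countable
structure `restrictions G`, with the inclusion of partial maps and the relation `r ⊆ p ∘ q`; in
terms of cosets, the relations say that one coset is contained in another one, and that the product
of two cosets is contained in a third one.

* By weak elimination of imaginaries, the groups `G_(K)` are exactly the open subgroups without a
  proper open subgroup of finite index, so a topological isomorphism induces an isomorphism of the
  structures (`nonempty_restrictions_equiv_of_topIso`).
* Conversely, `g ∈ G` is the union of its restrictions, and the union of their images under an
  isomorphism `restrictions G ≃ restrictions H` is a member of `H`; this yields a topological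
  isomorphism (`topIso_of_restrictions_equiv`).
* The structure is atomic: the height of `g|K` among its restrictions is finite, a bound on it
  bounds the number of generators of `K`, and by oligomorphy there are, up to conjugation, only
  finitely many tuples of bounded height (`isAtomic_restrictions`). By a back-and-forth argument,
  countable atomic structures with the same theory are isomorphic (`exists_equiv_of_sameType`).

So the complete theory of `restrictions G`, a point of the Cantor space, is a complete invariant
(`topIso_iff`), and it depends on `G` in a Borel way (`measurableSet_realize_sentence`).
-/

namespace OligoIso

open FirstOrder FirstOrder.Language

/-! ### Back and forth -/

/-- A back-and-forth system of finite partial bijections between countable types yields a bijection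
whose finite parts belong to the system. -/
theorem exists_equiv_of_backAndForth {A B : Type*} [Countable A] [Countable B]
    (S : List (A × B) → Prop)
    (hinj : ∀ l, S l → ∀ p ∈ l, ∀ q ∈ l, p.1 = q.1 ↔ p.2 = q.2)
    (hforth : ∀ l, S l → ∀ a, ∃ b, S ((a, b) :: l))
    (hback : ∀ l, S l → ∀ b, ∃ a, S ((a, b) :: l))
    (l₀ : List (A × B)) (hl₀ : S l₀) :
    ∃ e : A ≃ B, (∀ p ∈ l₀, e p.1 = p.2) ∧
      ∀ s : Finset A, ∃ l, S l ∧ ∀ a ∈ s, (a, e a) ∈ l := by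
  classical
  have := Encodable.ofCountable A
  have := Encodable.ofCountable B
  choose f hf using hforth
  choose g hg using hback
  let step : ℕ → {l // S l} → {l // S l} := fun n l =>
    match (Encodable.decode n : Option (A ⊕ B)) with
    | none => l
    | some (.inl a) => ⟨_, hf l.1 l.2 a⟩
    | some (.inr b) => ⟨_, hg l.1 l.2 b⟩
  let L' : ℕ → {l // S l} := fun n => Nat.rec ⟨l₀, hl₀⟩ (fun n l => step n l) n
  let L : ℕ → List (A × B) := fun n => (L' n).1
  have hLs : ∀ n, L (n + 1) = (step n (L' n)).1 := fun n => rfl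
  have hS : ∀ n, S (L n) := fun n => (L' n).2
  have hmono : Monotone (fun n => {p | p ∈ L n}) := by
    refine monotone_nat_of_le_succ fun n p (hp : p ∈ L n) => ?_
    change p ∈ L (n + 1)
    simp only [hLs, step]
    split
    · exact hp
    · exact List.mem_cons_of_mem _ hp
    · exact List.mem_cons_of_mem _ hp
  have hA : ∀ a, ∃ b n, (a, b) ∈ L n := fun a => by
    refine ⟨f _ (hS (Encodable.encode (Sum.inl a : A ⊕ B))) a,
      Encodable.encode (Sum.inl a : A ⊕ B) + 1, ?_⟩
    rw [hLs]
    simp only [step, Encodable.encodek]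
    exact List.mem_cons_self
  have hB : ∀ b, ∃ a n, (a, b) ∈ L n := fun b => by
    refine ⟨g _ (hS (Encodable.encode (Sum.inr b : A ⊕ B))) b,
      Encodable.encode (Sum.inr b : A ⊕ B) + 1, ?_⟩
    rw [hLs]
    simp only [step, Encodable.encodek]
    exact List.mem_cons_self
  have huniq : ∀ p q n m, p ∈ L n → q ∈ L m → (p.1 = q.1 ↔ p.2 = q.2) := by
    intro p q n m hp hq
    exact hinj _ (hS (max n m)) p (hmono (le_max_left n m) hp) q (hmono (le_max_right n m) hq)
  choose e n he using hA
  choose e' n' he' using hB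
  refine ⟨⟨e, e', fun a => ((huniq _ _ _ _ (he' (e a)) (he a)).2 rfl),
    fun b => ((huniq _ _ _ _ (he (e' b)) (he' b)).1 rfl)⟩, ?_, ?_⟩
  · intro p hp
    exact (huniq _ _ _ 0 (he p.1) hp).1 rfl
  · intro s
    obtain ⟨N, hN⟩ := (s.image n).bddAbove
    exact ⟨L N, hS N, fun a ha =>
      hmono (hN (Finset.mem_coe.2 (Finset.mem_image_of_mem n ha))) (he a)⟩

/-! ### Isolated types and atomic structures -/

section Models

variable {L : FirstOrder.Language.{0, 0}} {M N : Type} [L.Structure M] [L.Structure N]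

/-- Elementarily equivalent structures realize the same formulas, also in infinitely many variables:
only finitely many of them occur. -/
theorem exists_realize_of_elementarilyEquivalent (h : M ≅[L] N) [Nonempty N] {α : Type}
    {φ : L.Formula α} (hφ : ∃ v : α → M, φ.Realize v) : ∃ v : α → N, φ.Realize v := by
  classical
  have : Nonempty M := h.symm.nonempty
  have key : ∀ (K : Type) [L.Structure K] [Nonempty K],
      (∃ v : α → K, φ.Realize v) ↔ K ⊨ φ.exClosure := by
    intro K _ _
    rw [← Formula.exists_realize_equivSentence_iff_realize_exClosure]
    refine exists_congr fun v => ?_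
    rw [← Formula.realize_equivSentence_symm, Equiv.symm_apply_apply]
  rw [key] at hφ ⊢
  exact (h.realize_sentence _).1 hφ

theorem forall_realize_of_elementarilyEquivalent (h : M ≅[L] N) [Nonempty M] {α : Type}
    {φ : L.Formula α} (hφ : ∀ v : α → M, φ.Realize v) (v : α → N) : φ.Realize v := by
  by_contra hv
  obtain ⟨w, hw⟩ := exists_realize_of_elementarilyEquivalent h.symm (φ := φ.not) ⟨v, hv⟩
  exact hw (hφ w)

variable (L) in
/-- Two tuples, possibly in different structures, satisfy the same formulas. -/
def SameType {α : Type} (a : α → M) (b : α → N) : Prop :=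
  ∀ φ : L.Formula α, φ.Realize a ↔ φ.Realize b

theorem SameType.symm {α : Type} {a : α → M} {b : α → N} (h : SameType L a b) : SameType L b a :=
  fun φ => (h φ).symm

theorem SameType.comp {α β : Type} {a : α → M} {b : α → N} (h : SameType L a b) (f : β → α) :
    SameType L (a ∘ f) (b ∘ f) := fun φ => by
  simpa using h (φ.relabel f)

theorem sameType_of_imp {α : Type} {a : α → M} {b : α → N}
    (h : ∀ φ : L.Formula α, φ.Realize a → φ.Realize b) : SameType L a b :=
  fun φ => ⟨h φ, fun hb => by_contra fun ha => h φ.not ha hb⟩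

/-- The formula `χ` isolates the type of the tuple `a`. -/
def Isolates {α : Type} (χ : L.Formula α) (a : α → M) : Prop :=
  χ.Realize a ∧ ∀ b : α → M, χ.Realize b → SameType L a b

variable (L M) in
/-- Every finite tuple of `M` has an isolated type. -/
def IsAtomic : Prop :=
  ∀ (n : ℕ) (a : Fin n → M), ∃ χ : L.Formula (Fin n), Isolates χ a

/-- An isolating formula determines the type in every elementarily equivalent structure. -/
theorem Isolates.sameType [Nonempty M] (h : M ≅[L] N) {α : Type} {χ : L.Formula α}
    {a : α → M} (hχ : Isolates χ a) {b : α → N} (hb : χ.Realize b) : SameType L a b :=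
  sameType_of_imp fun φ hφ =>
    Formula.realize_imp.1 (forall_realize_of_elementarilyEquivalent h (φ := χ.imp φ)
      (fun v => Formula.realize_imp.2 fun hv => (hχ.2 v hv φ).1 hφ) b) hb

theorem sameType_elim0 (h : M ≅[L] N) [Nonempty M] :
    SameType L (Fin.elim0 : Fin 0 → M) (Fin.elim0 : Fin 0 → N) :=
  sameType_of_imp fun φ hφ => by
    have : Nonempty N := h.nonempty
    obtain ⟨v, hv⟩ := exists_realize_of_elementarilyEquivalent h ⟨_, hφ⟩
    rwa [Subsingleton.elim Fin.elim0 v]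

theorem SameType.exists_cons [Nonempty M] (h : M ≅[L] N) (hM : IsAtomic L M) {n : ℕ}
    {a : Fin n → M} {b : Fin n → N} (hab : SameType L a b) (c : M) :
    ∃ d : N, SameType L (Fin.cons c a : Fin (n + 1) → M) (Fin.cons d b : Fin (n + 1) → N) := by
  obtain ⟨χ, hχ⟩ := hM _ (Fin.cons c a : Fin (n + 1) → M)
  let ψ : L.Formula (Fin n) :=
    (χ.relabel (Fin.cases (Sum.inr ()) Sum.inl : Fin (n + 1) → Fin n ⊕ Unit)).iExs Unit
  have hcons : ∀ {K : Type} (x : Fin n → K) (i : Unit → K),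
      (Sum.elim x i ∘ (Fin.cases (Sum.inr ()) Sum.inl : Fin (n + 1) → Fin n ⊕ Unit)) =
        (Fin.cons (i ()) x : Fin (n + 1) → K) := by
    intro K x i
    funext j
    refine Fin.cases ?_ (fun j => ?_) j <;> rfl
  have ha : ψ.Realize a := by
    simp only [ψ, Formula.realize_iExs, Formula.realize_relabel, hcons]
    exact ⟨fun _ => c, hχ.1⟩
  have hb := (hab ψ).1 ha
  simp only [ψ, Formula.realize_iExs, Formula.realize_relabel, hcons] at hb
  obtain ⟨d, hd⟩ := hb
  exact ⟨d (), hχ.sameType h hd⟩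

/-- Countable atomic structures with the same theory are isomorphic, by an isomorphism that takes a
given tuple to a given tuple of the same type. -/
theorem exists_equiv_of_sameType [Countable M] [Countable N] [Nonempty M] (h : M ≅[L] N)
    (hM : IsAtomic L M) (hN : IsAtomic L N) {n : ℕ} {a : Fin n → M} {b : Fin n → N}
    (hab : SameType L a b) : ∃ e : M ≃[L] N, ∀ i, e (a i) = b i := by
  classical
  have : Nonempty N := h.nonempty
  let S : List (M × N) → Prop := fun l =>
    SameType L (fun i : Fin l.length => (l.get i).1) (fun i : Fin l.length => (l.get i).2)
  have hcons : ∀ (p : M × N) (l : List (M × N)),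
      S (p :: l) ↔ SameType L (Fin.cons p.1 (fun i : Fin l.length => (l.get i).1))
        (Fin.cons p.2 (fun i : Fin l.length => (l.get i).2)) := by
    intro p l
    have h1 : (fun i : Fin (p :: l).length => ((p :: l).get i).1) =
        Fin.cons p.1 (fun i : Fin l.length => (l.get i).1) := by
      funext j
      refine Fin.cases ?_ (fun j => ?_) j <;> rfl
    have h2 : (fun i : Fin (p :: l).length => ((p :: l).get i).2) =
        Fin.cons p.2 (fun i : Fin l.length => (l.get i).2) := by
      funext j
      refine Fin.cases ?_ (fun j => ?_) j <;> rfl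
    simp only [S]
    rw [h1, h2]
  have hinj : ∀ l, S l → ∀ p ∈ l, ∀ q ∈ l, p.1 = q.1 ↔ p.2 = q.2 := by
    intro l hl p hp q hq
    obtain ⟨i, rfl⟩ := List.get_of_mem hp
    obtain ⟨j, rfl⟩ := List.get_of_mem hq
    simpa using hl ((Term.var i).equal (Term.var j))
  obtain ⟨e, he, hS⟩ := exists_equiv_of_backAndForth S hinj
    (fun l hl c => by
      obtain ⟨d, hd⟩ := SameType.exists_cons h hM hl c
      exact ⟨d, (hcons _ _).2 hd⟩)
    (fun l hl d => by
      obtain ⟨c, hc⟩ := SameType.exists_cons h.symm hN hl.symm d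
      exact ⟨c, (hcons _ _).2 hc.symm⟩)
    (List.ofFn fun i => (a i, b i)) (by
      have := hab.comp (Fin.cast (List.length_ofFn (f := fun i => (a i, b i))))
      simp only [S, List.get_ofFn]
      exact this)
  have hpres : ∀ (k : ℕ) (x : Fin k → M), SameType L x (e ∘ x) := by
    intro k x
    obtain ⟨l, hl, hmem⟩ := hS (Finset.univ.image x)
    have : ∀ i, ∃ j : Fin l.length, l.get j = (x i, e (x i)) := fun i =>
      List.get_of_mem (hmem _ (Finset.mem_image_of_mem x (Finset.mem_univ i)))
    choose j hj using this
    have := hl.comp j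
    simpa only [Function.comp_def, hj] using this
  refine ⟨⟨e, ?_, ?_⟩, ?_⟩
  · intro k f x
    have := (hpres _ (Fin.cons (Structure.funMap f x) x) (Formula.graph f)).1
      (Formula.realize_graph.2 rfl)
    have hc : e ∘ (Fin.cons (Structure.funMap f x) x : Fin (k + 1) → M) =
        (Fin.cons (e (Structure.funMap f x)) (e ∘ x) : Fin (k + 1) → N) := by
      funext j
      refine Fin.cases ?_ (fun j => ?_) j <;> rfl
    rw [hc, Formula.realize_graph] at this
    exact this.symm
  · intro k R x
    have := (hpres k x (R.formula Term.var)).symm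
    rw [Formula.realize_rel, Formula.realize_rel] at this
    exact this
  · intro i
    exact he (a i, b i) (List.mem_ofFn.2 ⟨i, rfl⟩)

end Models

section RyllNardzewski

variable {L : FirstOrder.Language.{0, 0}} {M N : Type} [L.Structure M] [L.Structure N]

/-- If the realizations of a formula have only finitely many types, then these are isolated: each of
them is separated from the other ones by finitely many formulas. -/
theorem exists_isolates_of_finite {α : Type} {a : α → M} {χ : L.Formula α} (ha : χ.Realize a)
    {F : Set (α → M)} (hF : F.Finite) (hχ : ∀ b : α → M, χ.Realize b → ∃ c ∈ F, SameType L c b) :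
    ∃ χ' : L.Formula α, Isolates χ' a := by
  classical
  have : ∀ c : α → M, ∃ ψ : L.Formula α, ψ.Realize a ∧ (ψ.Realize c → SameType L a c) := by
    intro c
    by_cases h : SameType L a c
    · exact ⟨⊤, Formula.realize_top.2 trivial, fun _ => h⟩
    · have : ∃ φ : L.Formula α, φ.Realize a ∧ ¬ φ.Realize c := by
        by_contra! hcon
        exact h (sameType_of_imp hcon)
      obtain ⟨φ, h1, h2⟩ := this
      exact ⟨φ, h1, fun h => absurd h h2⟩
  choose ψ h1 h2 using this
  have := hF.to_subtype
  refine ⟨χ ⊓ Formula.iInf (fun c : F => ψ c), ?_, fun b hb => ?_⟩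
  · exact Formula.realize_inf.2 ⟨ha, Formula.realize_iInf.2 fun c => h1 c⟩
  · obtain ⟨hb, hb'⟩ := Formula.realize_inf.1 hb
    obtain ⟨c, hc, hcb⟩ := hχ b hb
    have h3 := h2 c ((hcb _).2 (Formula.realize_iInf.1 hb' ⟨c, hc⟩))
    exact fun φ => (h3 φ).trans (hcb φ)

theorem isAtomic_of_elementarilyEquivalent [Nonempty M] (h : M ≅[L] N)
    (hM : ∀ n, ∃ F : Set (Fin n → M), F.Finite ∧ ∀ b : Fin n → M, ∃ c ∈ F, SameType L c b) :
    IsAtomic L N := by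
  intro n b
  obtain ⟨F, hF, hFc⟩ := hM n
  have hiso : ∀ c : Fin n → M, ∃ χ : L.Formula (Fin n), Isolates χ c := fun c =>
    exists_isolates_of_finite (χ := ⊤) (Formula.realize_top.2 trivial) hF fun b _ => hFc b
  choose χ hχ using hiso
  have := hF.to_subtype
  have hall : ∀ v : Fin n → M, (Formula.iSup (fun c : F => χ c)).Realize v := by
    intro v
    obtain ⟨c, hc, hcv⟩ := hFc v
    exact Formula.realize_iSup.2 ⟨⟨c, hc⟩, (hcv _).1 (hχ c).1⟩
  obtain ⟨c, hc⟩ := Formula.realize_iSup.1 (forall_realize_of_elementarilyEquivalent h hall b)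
  refine ⟨χ c, hc, fun b' hb' φ => ?_⟩
  exact ((hχ c).sameType h hc φ).symm.trans ((hχ c).sameType h hb' φ)

/-! ### Compactness and countability -/

/-- Compactness, for sets of formulas that are finitely realized in `M`. -/
theorem exists_realize_of_finitely_realized [Nonempty M] {α : Type} (Γ : Set (L.Formula α))
    (hΓ : ∀ Γ₀ : Set (L.Formula α), Γ₀ ⊆ Γ → Γ₀.Finite → ∃ v : α → M, ∀ φ ∈ Γ₀, φ.Realize v) :
    ∃ (K : Type) (_ : L.Structure K), Nonempty K ∧ (M ≅[L] K) ∧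
      ∃ v : α → K, ∀ φ ∈ Γ, φ.Realize v := by
  classical
  let T : L[[α]].Theory := (L.lhomWithConstants α).onTheory (L.completeTheory M) ∪
    Formula.equivSentence '' Γ
  have hT : T.IsSatisfiable := by
    rw [Theory.isSatisfiable_iff_isFinitelySatisfiable]
    intro T₀ hT₀
    obtain ⟨v, hv⟩ := hΓ (Γ ∩ Formula.equivSentence ⁻¹' T₀) Set.inter_subset_left
      ((T₀.finite_toSet.preimage Formula.equivSentence.injective.injOn).inter_of_right _)
    let _ : (constantsOn α).Structure M := constantsOn.structure v
    have : M ⊨ (T₀ : L[[α]].Theory) := by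
      refine ⟨fun φ hφ => ?_⟩
      rcases hT₀ hφ with h | ⟨ψ, hψ, rfl⟩
      · exact ((LHom.onTheory_model (L.lhomWithConstants α) (L.completeTheory M)).2
          inferInstance).realize_of_mem _ h
      · rw [← Formula.realize_equivSentence_symm, Equiv.symm_apply_apply]
        exact hv ψ ⟨hψ, hφ⟩
    exact Theory.Model.isSatisfiable M
  obtain ⟨K⟩ := hT
  have hK : K ⊨ (L.lhomWithConstants α).onTheory (L.completeTheory M) :=
    Theory.Model.mono K.is_model Set.subset_union_left
  let _ := (L.lhomWithConstants α).reduct K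
  have : (L.lhomWithConstants α).IsExpansionOn K := LHom.isExpansionOn_reduct _ _
  have hK' : K ⊨ L.completeTheory M := (LHom.onTheory_model _ _).1 hK
  refine ⟨K, inferInstance, inferInstance, ?_, fun a => (L.con a : K), fun φ hφ => ?_⟩
  · rw [elementarilyEquivalent_iff]
    intro φ
    exact (realize_iff_of_model_completeTheory M K φ).symm
  · rw [← Formula.realize_equivSentence]
    exact K.is_model.realize_of_mem _ (Or.inr ⟨φ, hφ, rfl⟩)

theorem countable_formula [Countable L.Symbols] (α : Type) [Countable α] :
    Countable (L.Formula α) := by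
  have h : Cardinal.mk (Σ n, L.BoundedFormula α n) ≤ Cardinal.aleph0 := by
    refine BoundedFormula.card_le.trans (max_le le_rfl ?_)
    rw [Cardinal.lift_id, Cardinal.lift_id]
    exact Cardinal.add_le_aleph0.2 ⟨Cardinal.mk_le_aleph0, Cardinal.mk_le_aleph0 (α := L.Symbols)⟩
  have := Cardinal.mk_le_aleph0_iff.1 h
  exact Function.Injective.countable
    (f := fun φ : L.Formula α => (⟨0, φ⟩ : Σ n, L.BoundedFormula α n))
    (fun φ ψ h => by simpa using h)

theorem exists_countable_elementarySubstructure [Countable L.Symbols] [Infinite M]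
    (s : Set M) (hs : s.Countable) :
    ∃ S : L.ElementarySubstructure M, s ⊆ S ∧ Countable S := by
  obtain ⟨S, hS, hc⟩ := exists_elementarySubstructure_card_eq L s Cardinal.aleph0.{0} le_rfl
    (by simpa using hs) (by
      rw [Cardinal.lift_id, Cardinal.lift_id]
      exact Cardinal.mk_le_aleph0 (α := L.Symbols))
    (by simp)
  refine ⟨S, hS, ?_⟩
  rw [← Cardinal.mk_le_aleph0_iff]
  simpa using hc.le

/-! ### Omitting types -/

variable (M) in
theorem exists_finset_realize_congr {α : Type} (φ : L.Formula α) :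
    ∃ s : Finset α, ∀ v w : α → M, (∀ i ∈ s, v i = w i) → (φ.Realize v ↔ φ.Realize w) := by
  classical
  refine ⟨φ.freeVarFinset, fun v w h => ?_⟩
  have h1 := BoundedFormula.realize_restrictFreeVar (φ := φ) (f := id) (v := fun a => v a)
    (xs := (default : Fin 0 → M)) v (fun a => rfl)
  have h2 := BoundedFormula.realize_restrictFreeVar (φ := φ) (f := id) (v := fun a => v a)
    (xs := (default : Fin 0 → M)) w (fun a => h _ a.2)
  exact h1.symm.trans h2

/-- The Tarski-Vaught test for the range of a sequence. -/
theorem elementarySubstructure_of_witnesses [Nonempty M] (w : ℕ → M)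
    (hw : ∀ θ : L.Formula (ℕ ⊕ Unit), (∃ m : M, θ.Realize (Sum.elim w fun _ => m)) →
      ∃ j, θ.Realize (Sum.elim w fun _ => w j)) :
    ∃ S : L.ElementarySubstructure M, (S : Set M) = Set.range w := by
  have h : L.MeetsDefinable (Set.range w) := by
    rintro D ⟨x, hx⟩ ⟨φ, hφ⟩
    choose p hp using fun a : Set.range w => a.2
    let θ : L.Formula (ℕ ⊕ Unit) :=
      Formula.relabel (Sum.map p fun _ => ()) (BoundedFormula.constantsVarsEquiv φ : L.Formula _)
    have hθ : ∀ m, θ.Realize (Sum.elim w fun _ => m) ↔ m ∈ D := by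
      intro m
      have h1 : (fun _ => m : Fin 1 → M) ∈ {x : Fin 1 → M | x 0 ∈ D} ↔ m ∈ D := Iff.rfl
      rw [← h1, hφ]
      simp only [θ, Formula.realize_relabel, Set.mem_ofPred_eq]
      refine Iff.trans ?_ (BoundedFormula.realize_constantsVarsEquiv (φ := φ) (xs := default))
      rw [Formula.Realize]
      have : (Sum.elim w (fun _ => m) ∘ Sum.map p fun _ => () : Set.range w ⊕ Fin 1 → M) =
          Sum.elim (fun a => (L.con a : M)) fun _ => m := by
        funext a
        rcases a with a | a
        · exact hp a
        · rfl
      rw [this]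
    obtain ⟨j, hj⟩ := hw θ ⟨x, (hθ x).2 hx⟩
    exact ⟨w j, (hθ _).1 hj, j, rfl⟩
  exact ⟨h.toElementarySubstructure, h.closure_eq_self⟩

variable (L M) in
/-- The formulas in the variables `x₀, x₁, …` that are realized in `M`, as forcing conditions;
a condition is stronger than another one if it implies it in `M`. -/
def RealizedFormula : Type := {φ : L.Formula ℕ // ∃ v : ℕ → M, φ.Realize v}

instance : Preorder (RealizedFormula L M) where
  le φ ψ := ∀ v : ℕ → M, ψ.1.Realize v → φ.1.Realize v
  le_refl _ _ h := h
  le_trans _ _ _ h₁ h₂ v h := h₁ v (h₂ v h)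

/-- The conditions that decide against a witness for `θ`, or name one. -/
def witnessing (θ : L.Formula (ℕ ⊕ Unit)) : Order.Cofinal (RealizedFormula L M) where
  carrier := {φ | (∀ (v : ℕ → M) (m : M), φ.1.Realize v → ¬ θ.Realize (Sum.elim v fun _ => m)) ∨
    ∃ j, ∀ v : ℕ → M, φ.1.Realize v → θ.Realize (Sum.elim v fun _ => v j)}
  isCofinal := by
    classical
    intro φ
    by_cases h : ∀ (v : ℕ → M) (m : M), φ.1.Realize v → ¬ θ.Realize (Sum.elim v fun _ => m)
    · exact ⟨φ, Or.inl h, le_rfl⟩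
    push Not at h
    obtain ⟨v, m, hv, hm⟩ := h
    obtain ⟨s, hs⟩ := exists_finset_realize_congr M φ.1
    obtain ⟨t, ht⟩ := exists_finset_realize_congr M θ
    -- a variable that occurs neither in `φ` nor in `θ` can be made to name the witness `m`
    obtain ⟨j, hj⟩ := Infinite.exists_notMem_finset (s ∪ t.preimage Sum.inl Sum.inl_injective.injOn)
    simp only [Finset.mem_union, Finset.mem_preimage, not_or] at hj
    refine ⟨⟨φ.1 ⊓ θ.relabel (Sum.elim id fun _ => j), Function.update v j m, ?_⟩, Or.inr ⟨j, ?_⟩,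
      fun w hw => (Formula.realize_inf.1 hw).1⟩
    · refine Formula.realize_inf.2 ⟨(hs _ _ fun i hi => ?_).1 hv, ?_⟩
      · rw [Function.update_of_ne]
        rintro rfl
        exact hj.1 hi
      · rw [Formula.realize_relabel]
        refine (ht _ _ fun i hi => ?_).1 hm
        rcases i with i | i
        · have : i ≠ j := by
            rintro rfl
            exact hj.2 hi
          simp [this]
        · simp
    · intro w hw
      have := Formula.realize_relabel.1 (Formula.realize_inf.1 hw).2
      convert! this using 1
      funext i
      rcases i with i | i <;> rfl

/-- The conditions under which the variables `x_{s 0}, …, x_{s (n - 1)}` do not have the type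
of `a`. -/
def omitting {n : ℕ} (s : Fin n → ℕ) (a : Fin n → M)
    (ha : ¬ ∃ χ : L.Formula (Fin n), Isolates χ a) : Order.Cofinal (RealizedFormula L M) where
  carrier := {φ | ∃ θ : L.Formula (Fin n), θ.Realize a ∧
    ∀ v : ℕ → M, φ.1.Realize v → ¬ θ.Realize (v ∘ s)}
  isCofinal := by
    classical
    rintro ⟨φ, v, hv⟩
    -- `χ` says of a tuple that it is the restriction along `s` of a realization of `φ`; only the
    -- variables below `m + 1` matter
    obtain ⟨t, ht⟩ := exists_finset_realize_congr M φ
    obtain ⟨m, hm⟩ := (t ∪ Finset.univ.image s).bddAbove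
    let ρ : ℕ → Fin (m + 1) := fun k => ⟨min k m, by omega⟩
    let χ : L.Formula (Fin n) := Formula.iExs (Fin (m + 1)) (φ.relabel (Sum.inr ∘ ρ) ⊓
      Formula.iInf fun i => (Term.var (Sum.inl i)).equal (Term.var (Sum.inr (ρ (s i)))))
    have hχ : ∀ y : Fin n → M, χ.Realize y ↔
        ∃ u : Fin (m + 1) → M, φ.Realize (u ∘ ρ) ∧ ∀ i, y i = u (ρ (s i)) := by
      intro y
      simp only [χ, Formula.realize_iExs, Formula.realize_inf, Formula.realize_relabel,
        Formula.realize_iInf, Formula.realize_equal, Term.realize_var, Sum.elim_inl, Sum.elim_inr,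
        ← Function.comp_assoc, Sum.elim_comp_inr]
    have hχv : χ.Realize (v ∘ s) := by
      have hρ : ∀ k ∈ t ∪ Finset.univ.image s, v k = v (ρ k) := fun k hk => by
        simp [ρ, min_eq_left (hm hk)]
      refine (hχ _).2 ⟨fun j => v j, (ht _ _ fun k hk => ?_).1 hv, fun i => ?_⟩
      · exact hρ k (Finset.mem_union_left _ hk)
      · exact hρ (s i) (Finset.mem_union_right _ (Finset.mem_image_of_mem s (Finset.mem_univ i)))
    have hθ : ∃ θ : L.Formula (Fin n), θ.Realize a ∧
        ∃ y : Fin n → M, χ.Realize y ∧ ¬ θ.Realize y := by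
      by_cases hχa : χ.Realize a
      · by_contra! hcon
        exact ha ⟨χ, hχa, fun b hb => sameType_of_imp fun θ hθ => hcon θ hθ b hb⟩
      · exact ⟨χ.not, hχa, v ∘ s, hχv, fun h => h hχv⟩
    obtain ⟨θ, hθa, y, hy, hθy⟩ := hθ
    obtain ⟨u, hu, hyu⟩ := (hχ y).1 hy
    have hys : y = (u ∘ ρ) ∘ s := funext hyu
    refine ⟨⟨φ ⊓ (θ.relabel s).not, u ∘ ρ, ?_⟩, ⟨θ, hθa, fun w hw => ?_⟩,
      fun w hw => (Formula.realize_inf.1 hw).1⟩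
    · refine Formula.realize_inf.2 ⟨hu, ?_⟩
      rw [Formula.realize_not, Formula.realize_relabel, ← hys]
      exact hθy
    · have := (Formula.realize_inf.1 hw).2
      rwa [Formula.realize_not, Formula.realize_relabel] at this

/-- The omitting types theorem, for the nonisolated types of the countably many tuples of `M`. A
generic sequence of formulas is finitely realized in `M`, hence realized by a sequence in some
structure; its range is the required structure. -/
theorem exists_model_omitting_nonisolated [Nonempty M] [Countable M] [Countable L.Symbols] :
    ∃ (K : Type) (_ : L.Structure K), Countable K ∧ (M ≅[L] K) ∧
      ∀ (n : ℕ) (a : Fin n → M), (¬ ∃ χ : L.Formula (Fin n), Isolates χ a) →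
        ∀ b : Fin n → K, ¬ SameType L a b := by
  classical
  have := countable_formula (L := L) (ℕ ⊕ Unit)
  let ι := L.Formula (ℕ ⊕ Unit) ⊕ Σ n : ℕ, (Fin n → ℕ) ×
    {a : Fin n → M // ¬ ∃ χ : L.Formula (Fin n), Isolates χ a}
  have : Encodable ι := Encodable.ofCountable ι
  let 𝒟 : ι → Order.Cofinal (RealizedFormula L M) := fun i => match i with
    | .inl θ => witnessing θ
    | .inr ⟨_, s, a⟩ => omitting s a.1 a.2
  let p₀ : RealizedFormula L M :=
    ⟨⊤, fun _ => Classical.arbitrary M, Formula.realize_top.2 trivial⟩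
  let q : ℕ → RealizedFormula L M := Order.sequenceOfCofinals p₀ 𝒟
  have hq : Monotone q := Order.sequenceOfCofinals.monotone p₀ 𝒟
  obtain ⟨K, _, _, hMK, w, hw⟩ := exists_realize_of_finitely_realized (M := M)
    (Set.range fun n => (q n).1) (by
      intro Γ₀ hΓ₀ hfin
      choose! f hf using hΓ₀
      obtain ⟨N, hN⟩ := (hfin.image f).bddAbove
      obtain ⟨v, hv⟩ := (q N).2
      refine ⟨v, fun φ hφ => ?_⟩
      rw [← hf hφ]
      exact hq (hN (Set.mem_image_of_mem f hφ)) v hv)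
  have hmeet : ∀ i, ∃ φ ∈ 𝒟 i, φ.1.Realize w := fun i =>
    ⟨_, Order.sequenceOfCofinals.encode_mem p₀ 𝒟 i, hw _ ⟨_, rfl⟩⟩
  obtain ⟨S, hS⟩ := elementarySubstructure_of_witnesses w (by
    rintro θ ⟨m, hm⟩
    obtain ⟨φ, hφ | ⟨j, hj⟩, hφw⟩ := hmeet (.inl θ)
    · have := forall_realize_of_elementarilyEquivalent hMK
        (φ := (φ.1.relabel Sum.inl).imp θ.not) (fun v => Formula.realize_imp.2 fun hv => by
          have h := hφ (v ∘ Sum.inl) (v (Sum.inr ())) (Formula.realize_relabel.1 hv)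
          have hv' : (Sum.elim (v ∘ Sum.inl) fun _ => v (Sum.inr ())) = v := by
            funext i
            rcases i with i | i <;> rfl
          rwa [hv'] at h) (Sum.elim w fun _ => m)
      exact absurd hm (Formula.realize_imp.1 this (Formula.realize_relabel.2 (by simpa using hφw)))
    · have := forall_realize_of_elementarilyEquivalent hMK
        (φ := φ.1.imp (θ.relabel (Sum.elim id fun _ => j)))
        (fun v => Formula.realize_imp.2 fun hv =>
          Formula.realize_relabel.2 (by
            convert! hj v hv using 1
            funext i
            rcases i with i | i <;> rfl)) w
      refine ⟨j, ?_⟩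
      convert! Formula.realize_relabel.1 (Formula.realize_imp.1 this hφw) using 1
      funext i
      rcases i with i | i <;> rfl)
  refine ⟨S, inferInstance, ?_, hMK.trans S.elementarilyEquivalent.symm, ?_⟩
  · have : (S : Set K).Countable := hS ▸ Set.countable_range w
    exact this.to_subtype
  · intro n a ha b hab
    have : ∀ i, ∃ j, w j = b i := fun i => by
      have : (b i : K) ∈ (S : Set K) := (b i).2
      rwa [hS] at this
    choose s hs using this
    obtain ⟨φ, ⟨θ, hθa, hθ⟩, hφw⟩ := hmeet (.inr ⟨n, s, a, ha⟩)
    have h1 := forall_realize_of_elementarilyEquivalent hMK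
        (φ := φ.1.imp (θ.relabel s).not) (fun v => Formula.realize_imp.2 fun hv h =>
          hθ v hv (Formula.realize_relabel.1 h)) w
    refine Formula.realize_imp.1 h1 hφw (Formula.realize_relabel.2 ?_)
    have h2 := (S.subtype.map_formula θ b).2 ((hab θ).1 hθa)
    convert! h2 using 1
    funext i
    exact hs i

/-! ### The Ryll-Nardzewski theorem -/

theorem isOligomorphic_iff {G : Subgroup (Equiv.Perm ℕ)} :
    IsOligomorphic G ↔ ∀ n : ℕ, ∃ F : Finset (Fin n → ℕ), ∀ t : Fin n → ℕ,
      ∃ c ∈ F, ∃ g ∈ G, ∀ i, g (c i) = t i := by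
  classical
  refine forall_congr' fun n => ⟨fun h => ?_, ?_⟩
  · have := Fintype.ofFinite (MulAction.orbitRel.Quotient G (Fin n → ℕ))
    refine ⟨Finset.univ.image fun q : MulAction.orbitRel.Quotient G (Fin n → ℕ) => q.out,
      fun t => ?_⟩
    refine ⟨_, Finset.mem_image_of_mem _
      (Finset.mem_univ (Quotient.mk (MulAction.orbitRel G (Fin n → ℕ)) t)), ?_⟩
    obtain ⟨g, hg⟩ := (MulAction.orbitRel G (Fin n → ℕ)).symm
      (Quotient.mk_out (s := MulAction.orbitRel G (Fin n → ℕ)) t)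
    exact ⟨g.1, g.2, fun i => congrFun hg i⟩
  · rintro ⟨F, hF⟩
    refine Finite.of_surjective (fun c : F =>
      (Quotient.mk (MulAction.orbitRel G (Fin n → ℕ)) c.1)) fun q => ?_
    induction q using Quotient.inductionOn with | h t => ?_
    obtain ⟨c, hc, g, hg, hgt⟩ := hF t
    refine ⟨⟨c, hc⟩, Quotient.sound ((MulAction.orbitRel G (Fin n → ℕ)).symm ?_)⟩
    exact ⟨⟨g, hg⟩, funext hgt⟩

theorem sameType_of_equiv {M N : Type} [L.Structure M] [L.Structure N] (e : M ≃[L] N) {α : Type}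
    (a : α → M) : SameType L a (e ∘ a) := fun φ =>
  (StrongHomClass.realize_formula e φ).symm

theorem omegaCategorical_iff_countable [L.Structure ℕ] : OmegaCategorical L ↔
    ∀ (K : Type) [L.Structure K] [Countable K], (ℕ ≅[L] K) → Nonempty (ℕ ≃[L] K) := by
  constructor
  · intro h K _ _ hK
    have : Infinite K := hK.infinite
    have : Nonempty K := inferInstance
    have : K ⊨ L.completeTheory ℕ := hK.theory_model
    exact h (Theory.ModelType.of _ ℕ) (Theory.ModelType.of _ K) (Cardinal.mk_nat)
      (Cardinal.mk_eq_aleph0 K)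
  · intro h K₁ K₂ h₁ h₂
    have key : ∀ K : (L.completeTheory ℕ).ModelType, Cardinal.mk K = Cardinal.aleph0 →
        Nonempty (ℕ ≃[L] K) := by
      intro K hK
      have : Countable K := Cardinal.mk_le_aleph0_iff.1 hK.le
      refine h K ?_
      rw [elementarilyEquivalent_iff]
      exact fun φ => (realize_iff_of_model_completeTheory ℕ K φ).symm
    obtain ⟨e₁⟩ := key K₁ h₁
    obtain ⟨e₂⟩ := key K₂ h₂
    exact ⟨e₂.comp e₁.symm⟩

/-- A structure that is `ω`-categorical is isomorphic to one that omits its nonisolated types, hence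
it is atomic. If there were infinitely many orbits on `n`-tuples, then by compactness some countable
structure with the same theory would contain a tuple that satisfies none of the isolating
formulas. -/
theorem isOligomorphic_of_omegaCategorical [L.Structure ℕ] [Countable L.Symbols]
    (h : OmegaCategorical L) : IsOligomorphic (autGroup L) := by
  classical
  rw [omegaCategorical_iff_countable] at h
  have hat : IsAtomic L ℕ := by
    obtain ⟨K, _, _, hK, homit⟩ := exists_model_omitting_nonisolated (L := L) (M := ℕ)
    obtain ⟨e⟩ := h K hK
    intro n a
    by_contra ha
    exact homit n a ha (e ∘ a) (sameType_of_equiv e a)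
  choose χ hχ using hat
  rw [isOligomorphic_iff]
  intro n
  by_contra hcon
  push Not at hcon
  obtain ⟨K, _, _, hK, v, hv⟩ := exists_realize_of_finitely_realized (M := ℕ)
    (Set.range fun a : Fin n → ℕ => (χ n a).not) (by
      intro Γ₀ hΓ₀ hfin
      have hΓ₁ : ∀ φ : Γ₀, ∃ a, (χ n a).not = φ.1 := fun φ => hΓ₀ φ.2
      choose f hf using hΓ₁
      have := hfin.fintype
      obtain ⟨t, ht⟩ := hcon (Finset.univ.image f)
      refine ⟨t, fun φ hφ => ?_⟩
      rw [← show (χ n (f ⟨φ, hφ⟩)).not = φ from hf _]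
      intro hcon
      obtain ⟨e, he⟩ := exists_equiv_of_sameType (rfl : ℕ ≅[L] ℕ)
        (fun n a => ⟨χ n a, hχ n a⟩) (fun n a => ⟨χ n a, hχ n a⟩) ((hχ n (f ⟨φ, hφ⟩)).2 t hcon)
      obtain ⟨i, hi⟩ := ht (f ⟨φ, hφ⟩) (Finset.mem_image_of_mem f (Finset.mem_univ _))
        e.toEquiv ⟨e, rfl⟩
      exact hi (he i))
  have : Infinite K := hK.infinite
  obtain ⟨S, hS, _⟩ := exists_countable_elementarySubstructure (L := L) (Set.range v)
    (Set.countable_range v)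
  obtain ⟨e⟩ := h S (hK.trans S.elementarilyEquivalent.symm)
  let b : Fin n → S := fun i => ⟨v i, hS ⟨i, rfl⟩⟩
  refine hv _ ⟨e.symm ∘ b, rfl⟩ ?_
  have h1 := (sameType_of_equiv e (e.symm ∘ b) (χ n (e.symm ∘ b))).1 (hχ n _).1
  have h2 := (S.subtype.map_formula (χ n (e.symm ∘ b)) (e ∘ e.symm ∘ b)).2 h1
  have hev : S.subtype ∘ e ∘ e.symm ∘ b = v := by
    funext i
    simp [b]
  rwa [hev] at h2

theorem omegaCategorical_of_isOligomorphic [L.Structure ℕ] (h : IsOligomorphic (autGroup L)) :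
    OmegaCategorical L := by
  rw [isOligomorphic_iff] at h
  have hfin : ∀ n, ∃ F : Set (Fin n → ℕ), F.Finite ∧ ∀ b : Fin n → ℕ, ∃ c ∈ F, SameType L c b := by
    intro n
    obtain ⟨F, hF⟩ := h n
    refine ⟨F, F.finite_toSet, fun b => ?_⟩
    obtain ⟨c, hc, _, ⟨e, rfl⟩, he⟩ := hF b
    refine ⟨c, hc, ?_⟩
    have : b = e ∘ c := funext fun i => (he i).symm
    rw [this]
    exact sameType_of_equiv e c
  rw [omegaCategorical_iff_countable]
  intro K _ _ hK
  obtain ⟨e, -⟩ := exists_equiv_of_sameType hK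
    (isAtomic_of_elementarilyEquivalent (rfl : ℕ ≅[L] ℕ) hfin)
    (isAtomic_of_elementarilyEquivalent hK hfin) (sameType_elim0 hK)
  exact ⟨e⟩

end RyllNardzewski

/-! ### Oligomorphic groups and algebraic closure -/

section Acl

variable {G : Subgroup (Equiv.Perm ℕ)}

theorem mem_ptStab {A : Set ℕ} {g : Equiv.Perm ℕ} :
    g ∈ ptStab G A ↔ g ∈ G ∧ ∀ a ∈ A, g a = a := by
  rw [ptStab, Subgroup.mem_inf, mem_fixingSubgroup_iff]
  rfl

theorem mem_setStab_of_finite {A : Set ℕ} (hA : A.Finite) {g : Equiv.Perm ℕ} :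
    g ∈ setStab G A ↔ g ∈ G ∧ ∀ a ∈ A, g a ∈ A := by
  rw [setStab, Subgroup.mem_inf, MulAction.mem_stabilizer_set' hA]
  rfl

theorem ptStab_anti {A B : Set ℕ} (h : A ⊆ B) : ptStab G B ≤ ptStab G A := fun _ hg =>
  mem_ptStab.2 ⟨(mem_ptStab.1 hg).1, fun a ha => (mem_ptStab.1 hg).2 a (h ha)⟩

/-- Some finite set meets every orbit on finite sets of bounded size, in the sense that it contains
a translate of each of them. -/
theorem IsOligomorphic.exists_finset (hG : IsOligomorphic G) (N : ℕ) :
    ∃ X : Finset ℕ, ∀ B : Finset ℕ, B.card ≤ N → ∃ g ∈ G, ∀ x ∈ B, g x ∈ X := by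
  classical
  obtain ⟨F, hF⟩ := isOligomorphic_iff.1 hG N
  refine ⟨F.biUnion fun c => Finset.univ.image c, fun B hB => ?_⟩
  obtain ⟨c, hc, g, hg, hgt⟩ := hF fun i => B.toList.getD i 0
  refine ⟨g⁻¹, inv_mem hg, fun x hx => ?_⟩
  obtain ⟨i, hi, rfl⟩ := List.getElem_of_mem (Finset.mem_toList.2 hx)
  have hiN : i < N := lt_of_lt_of_le (by simpa using hi) hB
  have := hgt ⟨i, hiN⟩
  simp only [List.getD_eq_getElem _ _ hi] at this
  rw [← this]
  simp only [Equiv.Perm.coe_inv, Equiv.symm_apply_apply]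
  exact Finset.mem_biUnion.2 ⟨c, hc, Finset.mem_image_of_mem _ (Finset.mem_univ _)⟩

/-- The pointwise stabilizer of a finite set inherits the property of
`IsOligomorphic.exists_finset`. -/
theorem IsOligomorphic.exists_finset_ptStab (hG : IsOligomorphic G) (A : Finset ℕ) (N : ℕ) :
    ∃ X : Finset ℕ, ∀ B : Finset ℕ, B.card ≤ N → ∃ g ∈ ptStab G A, ∀ x ∈ B, g x ∈ X := by
  classical
  obtain ⟨Y, hY⟩ := hG.exists_finset (N + A.card)
  have hex : ∀ f : A → Y, ∃ k ∈ G, (∃ k' ∈ G, ∀ a : A, k' a = f a) → ∀ a : A, k a = f a := by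
    intro f
    by_cases h : ∃ k' ∈ G, ∀ a : A, k' a = f a
    · obtain ⟨k, hk, hkf⟩ := h
      exact ⟨k, hk, fun _ => hkf⟩
    · exact ⟨1, one_mem G, fun h' => absurd h' h⟩
  choose k hkG hk using hex
  refine ⟨Finset.univ.biUnion fun f => Y.image ⇑((k f)⁻¹ : Equiv.Perm ℕ), fun B hB => ?_⟩
  obtain ⟨g, hg, hgY⟩ := hY (B ∪ A) ((Finset.card_union_le _ _).trans (by omega))
  let f : A → Y := fun a => ⟨g a, hgY a (Finset.mem_union_right _ a.2)⟩
  have hf : ∀ a : A, k f a = f a := hk f ⟨g, hg, fun a => rfl⟩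
  refine ⟨(k f)⁻¹ * g, mem_ptStab.2 ⟨mul_mem (inv_mem (hkG f)) hg, fun a ha => ?_⟩, fun x hx => ?_⟩
  · rw [Equiv.Perm.mul_apply, Equiv.Perm.inv_eq_iff_eq]
    exact (hf ⟨a, ha⟩).symm
  · exact Finset.mem_biUnion.2 ⟨f, Finset.mem_univ _,
      Finset.mem_image_of_mem _ (hgY x (Finset.mem_union_left _ hx))⟩

theorem mem_acl_iff {A : Set ℕ} {a : ℕ} :
    a ∈ acl G A ↔ ∃ O : Set ℕ, O.Finite ∧ ∀ g ∈ ptStab G A, g a ∈ O := by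
  constructor
  · exact fun h => ⟨_, h, fun g hg => ⟨⟨g, hg⟩, rfl⟩⟩
  · rintro ⟨O, hO, h⟩
    refine hO.subset ?_
    rintro _ ⟨g, rfl⟩
    exact h g.1 g.2

theorem subset_acl (A : Set ℕ) : A ⊆ acl G A := fun a ha =>
  mem_acl_iff.2 ⟨{a}, Set.finite_singleton a, fun _ hg => (mem_ptStab.1 hg).2 a ha⟩

theorem acl_mono {A B : Set ℕ} (h : A ⊆ B) : acl G A ⊆ acl G B := fun a ha => by
  obtain ⟨O, hO, hOa⟩ := mem_acl_iff.1 ha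
  exact mem_acl_iff.2 ⟨O, hO, fun g hg => hOa g (ptStab_anti h hg)⟩

theorem mem_of_forall_fixed {K : Set ℕ} (hK : acl G K = K) {x : ℕ}
    (h : ∀ g ∈ ptStab G K, g x = x) : x ∈ K := by
  rw [← hK]
  exact mem_acl_iff.2 ⟨{x}, Set.finite_singleton x, h⟩

theorem IsOligomorphic.finite_acl (hG : IsOligomorphic G) {A : Set ℕ} (hA : A.Finite) :
    (acl G A).Finite := by
  obtain ⟨X, hX⟩ := hG.exists_finset_ptStab hA.toFinset 1
  rw [hA.coe_toFinset] at hX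
  refine (Set.Finite.biUnion (s := {y | y ∈ X ∧ y ∈ acl G A})
    (X.finite_toSet.subset fun y hy => hy.1)
    (t := fun y => MulAction.orbit (ptStab G A) y) fun y hy => hy.2).subset fun x hx => ?_
  obtain ⟨g, hg, hgX⟩ := hX {x} (by simp)
  have hmem : g x ∈ MulAction.orbit (ptStab G A) x := ⟨⟨g, hg⟩, rfl⟩
  have heq : MulAction.orbit (ptStab G A) (g x) = MulAction.orbit (ptStab G A) x :=
    MulAction.orbit_eq_iff.2 hmem
  refine Set.mem_biUnion (x := g x) ⟨hgX x (Finset.mem_singleton_self x), ?_⟩ ?_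
  · change (MulAction.orbit (ptStab G A) (g x)).Finite
    rw [heq]
    exact hx
  · rw [heq]
    exact MulAction.mem_orbit_self x

/-- A point has a finite orbit under `V` if it has one under the elements that a map with finite
range does not distinguish from the identity; the map plays the role of the projection to the cosets
of a subgroup of finite index. -/
theorem exists_finite_of_finite_cosets {V : Subgroup (Equiv.Perm ℕ)} {β : Type*} [Finite β]
    (φ : V → β) {O : Set ℕ} (hO : O.Finite) {x : ℕ}
    (h : ∀ v w : V, φ v = φ w → (w⁻¹ * v : Equiv.Perm ℕ) x ∈ O) :
    ∃ O' : Set ℕ, O'.Finite ∧ ∀ v ∈ V, v x ∈ O' := by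
  choose f hf using fun b : Set.range φ => (b.2 : ∃ v, φ v = b)
  refine ⟨⋃ b : Set.range φ, (f b : Equiv.Perm ℕ) '' O,
    Set.finite_iUnion fun b => hO.image _, fun v hv => ?_⟩
  refine Set.mem_iUnion.2 ⟨⟨φ ⟨v, hv⟩, _, rfl⟩, _, h ⟨v, hv⟩ _ (hf ⟨φ ⟨v, hv⟩, _, rfl⟩).symm, ?_⟩
  simp

theorem apply_mem_acl {A : Set ℕ} {g : Equiv.Perm ℕ} (hg : g ∈ ptStab G A) {x : ℕ}
    (hx : x ∈ acl G A) : g x ∈ acl G A := by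
  obtain ⟨O, hO, h⟩ := mem_acl_iff.1 hx
  exact mem_acl_iff.2 ⟨O, hO, fun k hk => h (k * g) (mul_mem hk hg)⟩

theorem acl_acl {A : Set ℕ} (hA : (acl G A).Finite) : acl G (acl G A) = acl G A := by
  refine (subset_acl _).antisymm' fun x hx => ?_
  obtain ⟨O, hO, h⟩ := mem_acl_iff.1 hx
  have := hA.to_subtype
  refine mem_acl_iff.2 (exists_finite_of_finite_cosets
    (fun (v : ptStab G A) (a : acl G A) => (⟨v.1 a, apply_mem_acl v.2 a.2⟩ : acl G A)) hO
    fun v w hvw => h _ (mem_ptStab.2 ⟨?_, fun a ha => ?_⟩))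
  · exact mul_mem (inv_mem (mem_ptStab.1 w.2).1) (mem_ptStab.1 v.2).1
  · change (w.1⁻¹ : Equiv.Perm ℕ) (v.1 a) = a
    rw [Equiv.Perm.inv_eq_iff_eq]
    exact congrArg Subtype.val (congrFun hvw ⟨a, ha⟩)

theorem acl_image {g : Equiv.Perm ℕ} (hg : g ∈ G) (A : Set ℕ) : acl G (g '' A) = g '' acl G A := by
  have key : ∀ (g : Equiv.Perm ℕ) (_ : g ∈ G) (A : Set ℕ), g '' acl G A ⊆ acl G (g '' A) := by
    rintro g hg A _ ⟨x, hx, rfl⟩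
    obtain ⟨O, hO, h⟩ := mem_acl_iff.1 hx
    refine mem_acl_iff.2 ⟨g '' O, hO.image g, fun k hk => ?_⟩
    refine ⟨(g⁻¹ * k * g) x, h _ (mem_ptStab.2 ⟨?_, fun a ha => ?_⟩), by simp⟩
    · exact mul_mem (mul_mem (inv_mem hg) (mem_ptStab.1 hk).1) hg
    · simp [(mem_ptStab.1 hk).2 (g a) (Set.mem_image_of_mem g ha)]
  refine (key g hg A).antisymm' fun x hx => ?_
  have := key g⁻¹ (inv_mem hg) (g '' A) (Set.mem_image_of_mem _ hx)
  rw [← Set.image_comp] at this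
  have hid : (⇑g⁻¹ ∘ ⇑g) = id := by
    funext y
    simp
  rw [hid, Set.image_id] at this
  exact ⟨_, this, by simp⟩

theorem IsOligomorphic.exists_aclClosed (hG : IsOligomorphic G) {A : Set ℕ} (hA : A.Finite) :
    ∃ K : Finset ℕ, acl G K = K ∧ A ⊆ K := by
  refine ⟨(hG.finite_acl hA).toFinset, ?_, ?_⟩
  · rw [Set.Finite.coe_toFinset]
    exact acl_acl (hG.finite_acl hA)
  · rw [Set.Finite.coe_toFinset]
    exact subset_acl A

end Acl

/-! ### The topology of pointwise convergence -/

theorem isOpen_agree (s : Finset ℕ) (p : ℕ → ℕ) :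
    IsOpen {g : Equiv.Perm ℕ | ∀ a ∈ s, g a = p a} := by
  have : {g : Equiv.Perm ℕ | ∀ a ∈ s, g a = p a} =
      (fun (σ : Equiv.Perm ℕ) (n : ℕ) => σ n) ⁻¹' (Set.pi (s : Set ℕ) fun a => {p a}) := by
    ext g
    simp [Set.mem_pi]
  rw [this]
  exact isOpen_induced (isOpen_set_pi s.finite_toSet fun a _ => isOpen_discrete _)

theorem exists_finset_of_isOpen {U : Set (Equiv.Perm ℕ)} (hU : IsOpen U) {g : Equiv.Perm ℕ}
    (hg : g ∈ U) : ∃ s : Finset ℕ, ∀ h : Equiv.Perm ℕ, (∀ a ∈ s, h a = g a) → h ∈ U := by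
  obtain ⟨V, hV, rfl⟩ := isOpen_induced_iff.1 hU
  obtain ⟨s, u, hu, hsu⟩ := isOpen_pi_iff.1 hV _ hg
  refine ⟨s, fun h hh => hsu fun a ha => ?_⟩
  change h a ∈ u a
  rw [hh a ha]
  exact (hu a ha).2

theorem mem_of_forall_finset (G : ClosedSubgroup (Equiv.Perm ℕ)) {σ : Equiv.Perm ℕ}
    (h : ∀ s : Finset ℕ, ∃ g ∈ G.toSubgroup, ∀ a ∈ s, g a = σ a) : σ ∈ G.toSubgroup := by
  by_contra hσ
  obtain ⟨s, hs⟩ := exists_finset_of_isOpen G.isClosed'.isOpen_compl (g := σ) hσ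
  obtain ⟨g, hg, hgs⟩ := h s
  exact hs g hgs hg

/-! ### The canonical structure of a closed subgroup -/

/-- The relational language with one `n`-ary relation symbol for each orbit of `G` on `n`-tuples. -/
def orbitLanguage (G : Subgroup (Equiv.Perm ℕ)) : FirstOrder.Language.{0, 0} :=
  ⟨fun _ => Empty, fun n => MulAction.orbitRel.Quotient G (Fin n → ℕ)⟩

instance (G : Subgroup (Equiv.Perm ℕ)) : (orbitLanguage G).Structure ℕ where
  funMap f := f.elim
  RelMap R x := Quotient.mk (MulAction.orbitRel G _) x = R

theorem countable_orbitLanguage {G : Subgroup (Equiv.Perm ℕ)} (hG : IsOligomorphic G) :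
    Countable (orbitLanguage G).Symbols := by
  have (n : ℕ) : Countable ((orbitLanguage G).Functions n) := inferInstanceAs (Countable Empty)
  have (n : ℕ) : Countable ((orbitLanguage G).Relations n) := by
    have := hG n
    exact inferInstanceAs (Countable (MulAction.orbitRel.Quotient G (Fin n → ℕ)))
  exact inferInstanceAs (Countable (_ ⊕ _))

theorem autGroup_orbitLanguage (G : ClosedSubgroup (Equiv.Perm ℕ)) :
    autGroup (orbitLanguage G.toSubgroup) = G.toSubgroup := by
  ext σ
  constructor
  · rintro ⟨e, rfl⟩
    refine mem_of_forall_finset G fun s => ?_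
    obtain ⟨n, hn⟩ := s.bddAbove
    let t : Fin (n + 1) → ℕ := fun i => i
    have h := (e.map_rel' (Quotient.mk (MulAction.orbitRel G.toSubgroup _) t :
      (orbitLanguage G.toSubgroup).Relations (n + 1)) t).2 rfl
    obtain ⟨g, hg⟩ := Quotient.exact h
    refine ⟨g.1, g.2, fun a ha => ?_⟩
    exact congrFun hg (⟨a, Nat.lt_succ_of_le (hn ha)⟩ : Fin (n + 1))
  · intro hσ
    refine ⟨⟨σ, fun f => f.elim, fun {n} R x => ?_⟩, rfl⟩
    have : Quotient.mk (MulAction.orbitRel G.toSubgroup _) (σ ∘ x) =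
        Quotient.mk (MulAction.orbitRel G.toSubgroup _) x :=
      Quotient.sound ⟨⟨σ, hσ⟩, rfl⟩
    exact ⟨fun h => this.symm.trans h, fun h => this.trans h⟩

theorem autOmegaCatWEI_eq :
    autOmegaCatWEI = {G | IsOligomorphic G.toSubgroup ∧ WeakEI G.toSubgroup} := by
  ext G
  constructor
  · rintro ⟨L, _, _, hcat, hwei, hG⟩
    rw [hG] at hwei
    exact ⟨hG ▸ isOligomorphic_of_omegaCategorical hcat, hwei⟩
  · rintro ⟨holi, hwei⟩
    have hG := autGroup_orbitLanguage G
    refine ⟨orbitLanguage G.toSubgroup, countable_orbitLanguage holi, inferInstance, ?_, ?_, hG⟩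
    · exact omegaCategorical_of_isOligomorphic (by rwa [hG])
    · rwa [hG]

/-! ### Borel sets of closed subgroups -/

theorem measurableSet_forall {α ι : Type*} [MeasurableSpace α] [Countable ι] {p : ι → α → Prop}
    (h : ∀ i, MeasurableSet {a | p i a}) : MeasurableSet {a | ∀ i, p i a} := by
  rw [Set.ofPred_forall]
  exact MeasurableSet.iInter h

theorem measurableSet_exists {α ι : Type*} [MeasurableSpace α] [Countable ι] {p : ι → α → Prop}
    (h : ∀ i, MeasurableSet {a | p i a}) : MeasurableSet {a | ∃ i, p i a} := by
  rw [Set.ofPred_exists]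
  exact MeasurableSet.iUnion h

theorem measurableSet_imp {α : Type*} [MeasurableSpace α] {p q : α → Prop}
    (hp : MeasurableSet {a | p a}) (hq : MeasurableSet {a | q a}) :
    MeasurableSet {a | p a → q a} :=
  hp.himp hq

theorem measurableSet_exists_mem_isOpen {U : Set (Equiv.Perm ℕ)} (hU : IsOpen U) :
    MeasurableSet {G : ClosedSubgroup (Equiv.Perm ℕ) | ∃ g ∈ G.toSubgroup, g ∈ U} :=
  MeasurableSpace.measurableSet_generateFrom ⟨U, hU, rfl⟩

/-- Quantification over the members of a closed subgroup preserves Borel sets if only the values at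
finitely many points matter, since there are only countably many possibilities for these. -/
theorem measurableSet_exists_mem (A : Finset ℕ)
    {Q : ClosedSubgroup (Equiv.Perm ℕ) → Equiv.Perm ℕ → Prop}
    (hA : ∀ G g h, (∀ a ∈ A, g a = h a) → Q G g → Q G h)
    (hQ : ∀ g, MeasurableSet {G | Q G g}) :
    MeasurableSet {G | ∃ g ∈ G.toSubgroup, Q G g} := by
  classical
  have hrep : ∀ p : A → ℕ, ∃ r : Equiv.Perm ℕ, (∃ r' : Equiv.Perm ℕ, ∀ a : A, r' a = p a) →
      ∀ a : A, r a = p a := by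
    intro p
    by_cases h : ∃ r' : Equiv.Perm ℕ, ∀ a : A, r' a = p a
    · exact ⟨h.choose, fun _ => h.choose_spec⟩
    · exact ⟨1, fun h' => absurd h' h⟩
  choose r hr using hrep
  have : {G : ClosedSubgroup (Equiv.Perm ℕ) | ∃ g ∈ G.toSubgroup, Q G g} = ⋃ p : A → ℕ,
      {G | ∃ g ∈ G.toSubgroup, g ∈ {g : Equiv.Perm ℕ | ∀ a : A, g a = p a}} ∩
        {G | Q G (r p)} := by
    ext G
    simp only [Set.mem_ofPred_eq, Set.mem_iUnion, Set.mem_inter_iff]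
    constructor
    · rintro ⟨g, hg, hQg⟩
      have := hr (fun a => g a) ⟨g, fun _ => rfl⟩
      exact ⟨fun a => g a, ⟨g, hg, fun _ => rfl⟩, hA G g _ (fun a ha => (this ⟨a, ha⟩).symm) hQg⟩
    · rintro ⟨p, ⟨g, hg, hgp⟩, hQg⟩
      have := hr p ⟨g, hgp⟩
      exact ⟨g, hg, hA G _ g (fun a ha => (this ⟨a, ha⟩).trans (hgp ⟨a, ha⟩).symm) hQg⟩
  rw [this]
  refine MeasurableSet.iUnion fun p => (measurableSet_exists_mem_isOpen ?_).inter (hQ _)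
  convert! isOpen_agree A (fun a => if ha : a ∈ A then p ⟨a, ha⟩ else 0) using 1
  ext g
  simp only [Set.mem_ofPred_eq, Subtype.forall]
  exact forall₂_congr fun a ha => by rw [dif_pos ha]

theorem measurableSet_forall_mem (A : Finset ℕ)
    {Q : ClosedSubgroup (Equiv.Perm ℕ) → Equiv.Perm ℕ → Prop}
    (hA : ∀ G g h, (∀ a ∈ A, g a = h a) → Q G g → Q G h)
    (hQ : ∀ g, MeasurableSet {G | Q G g}) :
    MeasurableSet {G | ∀ g ∈ G.toSubgroup, Q G g} := by
  have := (measurableSet_exists_mem A (Q := fun G g => ¬ Q G g)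
    (fun G g h hgh hg hh => hg (hA G h g (fun a ha => (hgh a ha).symm) hh))
    fun g => (hQ g).compl).compl
  convert! this using 1
  ext G
  simp

theorem measurableSet_oligomorphicGroups : MeasurableSet oligomorphicGroups := by
  classical
  simp only [oligomorphicGroups, isOligomorphic_iff]
  refine measurableSet_forall fun n => measurableSet_exists fun F =>
    measurableSet_forall fun t => ?_
  refine measurableSet_exists fun c => MeasurableSet.const _ |>.inter ?_
  refine measurableSet_exists_mem (Finset.univ.image c) (fun G g h hgh hg i => ?_)
    fun g => MeasurableSet.const _
  rw [← hg i, hgh _ (Finset.mem_image_of_mem c (Finset.mem_univ i))]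

theorem measurableSet_mem_acl (K : Finset ℕ) (x : ℕ) :
    MeasurableSet {G : ClosedSubgroup (Equiv.Perm ℕ) | x ∈ acl G.toSubgroup K} := by
  have : {G : ClosedSubgroup (Equiv.Perm ℕ) | x ∈ acl G.toSubgroup K} =
      {G | ∃ O : Finset ℕ, ∀ g ∈ G.toSubgroup, (∀ a ∈ K, g a = a) → g x ∈ O} := by
    ext G
    simp only [Set.mem_ofPred_eq, mem_acl_iff, mem_ptStab, and_imp]
    constructor
    · rintro ⟨O, hO, h⟩
      exact ⟨hO.toFinset, by simpa using h⟩
    · rintro ⟨O, h⟩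
      exact ⟨O, O.finite_toSet, by simpa using h⟩
  rw [this]
  refine measurableSet_exists fun O => measurableSet_forall_mem (insert x K)
    (fun G g h hgh hg hh => ?_) fun g => MeasurableSet.const _
  rw [← hgh x (Finset.mem_insert_self x K)]
  exact hg fun a ha => (hgh a (Finset.mem_insert_of_mem ha)).trans (hh a ha)

theorem measurableSet_acl_eq (K : Finset ℕ) :
    MeasurableSet {G : ClosedSubgroup (Equiv.Perm ℕ) | acl G.toSubgroup K = K} := by
  have : {G : ClosedSubgroup (Equiv.Perm ℕ) | acl G.toSubgroup K = K} =
      {G | ∀ x, x ∈ acl G.toSubgroup K → x ∈ K} := by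
    ext G
    exact ⟨fun h x hx => by rwa [h] at hx, fun h => (subset_acl _).antisymm' h⟩
  rw [this]
  exact measurableSet_forall fun x =>
    measurableSet_imp (measurableSet_mem_acl K x) (MeasurableSet.const _)

/-- The permutations `g` that agree on `C` with `u ∘ p`, for some partial map `p ∈ F` with domain
`C` and some `u` in `G` that fixes `C` pointwise. If `G` is oligomorphic, every subgroup of `G` that
contains the pointwise stabilizer of `C` consists of the members of `G` in such a set, for a finite
set `F`. -/
def InDoubleCosets (G : Subgroup (Equiv.Perm ℕ)) (C : Finset ℕ) (F : Finset (Finset (ℕ × ℕ)))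
    (g : Equiv.Perm ℕ) : Prop :=
  ∃ p ∈ F, ∃ u ∈ G, (∀ c ∈ C, u c = c) ∧ ∀ c ∈ C, ∃ d, (c, d) ∈ p ∧ u d = g c

theorem InDoubleCosets.congr {G : Subgroup (Equiv.Perm ℕ)} {C : Finset ℕ}
    {F : Finset (Finset (ℕ × ℕ))} {g h : Equiv.Perm ℕ} (hgh : ∀ c ∈ C, g c = h c)
    (hg : InDoubleCosets G C F g) : InDoubleCosets G C F h := by
  obtain ⟨p, hp, u, hu, huC, H⟩ := hg
  refine ⟨p, hp, u, hu, huC, fun c hc => ?_⟩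
  rw [← hgh c hc]
  exact H c hc

theorem measurableSet_inDoubleCosets (C : Finset ℕ) (F : Finset (Finset (ℕ × ℕ)))
    (g : Equiv.Perm ℕ) : MeasurableSet
      {G : ClosedSubgroup (Equiv.Perm ℕ) | InDoubleCosets G.toSubgroup C F g} := by
  refine measurableSet_exists fun p => (MeasurableSet.const _).inter ?_
  refine measurableSet_exists_mem (C ∪ p.image Prod.snd) (fun G u v huv => ?_)
    fun g => MeasurableSet.const _
  rintro ⟨h1, h2⟩
  refine ⟨fun c hc => ?_, fun c hc => ?_⟩
  · rw [← huv c (Finset.mem_union_left _ hc), h1 c hc]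
  · obtain ⟨d, hd, hdc⟩ := h2 c hc
    refine ⟨d, hd, ?_⟩
    rw [← huv d (Finset.mem_union_right _ (Finset.mem_image_of_mem Prod.snd hd)), hdc]

/-- The members of `G` in the double cosets given by `C` and `F` form a subgroup. Closure under
division is stated in the form `g, g * h ∈ S → h ∈ S`, where no inverse occurs: for fixed `h` it
depends on finitely many values of `g` only. -/
def IsSubgroupCode (G : Subgroup (Equiv.Perm ℕ)) (C : Finset ℕ) (F : Finset (Finset (ℕ × ℕ))) :
    Prop :=
  InDoubleCosets G C F 1 ∧ ∀ h ∈ G, ∀ g ∈ G,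
    InDoubleCosets G C F g → InDoubleCosets G C F (g * h) → InDoubleCosets G C F h

theorem measurableSet_isSubgroupCode (C : Finset ℕ) (F : Finset (Finset (ℕ × ℕ))) :
    MeasurableSet {G : ClosedSubgroup (Equiv.Perm ℕ) | IsSubgroupCode G.toSubgroup C F} := by
  refine (measurableSet_inDoubleCosets C F 1).inter (measurableSet_forall_mem C ?_ fun h =>
    measurableSet_forall_mem (C ∪ C.image h) ?_ fun g =>
      (measurableSet_inDoubleCosets C F g).imp ((measurableSet_inDoubleCosets C F (g * h)).imp
        (measurableSet_inDoubleCosets C F h)))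
  · intro G h h' hh H g hg hg1 hg2
    refine (H g hg hg1 (hg2.congr fun c hc => ?_)).congr hh
    rw [Equiv.Perm.mul_apply, Equiv.Perm.mul_apply, hh c hc]
  · intro G g g' hgg H hg1 hg2
    refine H (hg1.congr fun c hc => (hgg c (Finset.mem_union_left _ hc)).symm)
      (hg2.congr fun c hc => ?_)
    rw [Equiv.Perm.mul_apply, Equiv.Perm.mul_apply,
      hgg _ (Finset.mem_union_right _ (Finset.mem_image_of_mem h hc))]

/-- The subgroup given by `C` and `F` lies between the pointwise and the setwise stabilizer of the
algebraically closed set `K`. -/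
def IsSupport (G : Subgroup (Equiv.Perm ℕ)) (C : Finset ℕ) (F : Finset (Finset (ℕ × ℕ)))
    (K : Finset ℕ) : Prop :=
  acl G K = K ∧ (∀ g ∈ G, (∀ a ∈ K, g a = a) → InDoubleCosets G C F g) ∧
    ∀ g ∈ G, InDoubleCosets G C F g → ∀ a ∈ K, g a ∈ K

theorem measurableSet_isSupport (C : Finset ℕ) (F : Finset (Finset (ℕ × ℕ))) (K : Finset ℕ) :
    MeasurableSet {G : ClosedSubgroup (Equiv.Perm ℕ) | IsSupport G.toSubgroup C F K} := by
  refine (measurableSet_acl_eq K).inter (MeasurableSet.inter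
    (measurableSet_forall_mem (C ∪ K) ?_ fun g =>
      measurableSet_imp (MeasurableSet.const _) (measurableSet_inDoubleCosets C F g))
    (measurableSet_forall_mem (C ∪ K) ?_ fun g =>
      measurableSet_imp (measurableSet_inDoubleCosets C F g) (MeasurableSet.const _)))
  · intro G g h hgh hg hh
    refine (hg fun a ha => ?_).congr fun c hc => hgh c (Finset.mem_union_left _ hc)
    rw [hgh a (Finset.mem_union_right _ ha), hh a ha]
  · intro G g h hgh hg hh a ha
    rw [← hgh a (Finset.mem_union_right _ ha)]
    exact hg (hh.congr fun c hc => (hgh c (Finset.mem_union_left _ hc)).symm) a ha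

/-- In an oligomorphic group, a subgroup that contains the pointwise stabilizer of `C` is the union
of finitely many double cosets of it. -/
theorem exists_inDoubleCosets {G : Subgroup (Equiv.Perm ℕ)} (hG : IsOligomorphic G)
    {H : Subgroup (Equiv.Perm ℕ)} (hHG : H ≤ G) {C : Finset ℕ} (hC : ptStab G C ≤ H) :
    ∃ F, ∀ g, g ∈ H ↔ g ∈ G ∧ InDoubleCosets G C F g := by
  classical
  obtain ⟨X, hX⟩ := hG.exists_finset_ptStab C C.card
  refine ⟨(C ×ˢ X).powerset.filter fun p => ∃ h ∈ H, p = C.image fun c => (c, h c),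
    fun g => ⟨fun hg => ⟨hHG hg, ?_⟩, ?_⟩⟩
  · obtain ⟨u, hu, huX⟩ := hX (C.image g) Finset.card_image_le
    have hinv := mem_ptStab.1 (inv_mem hu)
    refine ⟨C.image fun c => (c, (u * g) c), ?_, u⁻¹, hinv.1, hinv.2, fun c hc => ?_⟩
    · refine Finset.mem_filter.2 ⟨Finset.mem_powerset.2 fun x hx => ?_, u * g,
        mul_mem (hC hu) hg, rfl⟩
      obtain ⟨c, hc, rfl⟩ := Finset.mem_image.1 hx
      exact Finset.mem_product.2 ⟨hc, huX _ (Finset.mem_image_of_mem g hc)⟩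
    · exact ⟨(u * g) c, Finset.mem_image_of_mem _ hc, by simp⟩
  · rintro ⟨hg, p, hp, u, hu, huC, hpu⟩
    obtain ⟨-, h, hh, rfl⟩ := Finset.mem_filter.1 hp
    have huH : u ∈ H := hC (mem_ptStab.2 ⟨hu, huC⟩)
    have : (u * h)⁻¹ * g ∈ H := by
      refine hC (mem_ptStab.2 ⟨mul_mem (inv_mem (mul_mem hu (hHG hh))) hg, fun c hc => ?_⟩)
      obtain ⟨d, hd, hdc⟩ := hpu c hc
      obtain ⟨c', -, hcd⟩ := Finset.mem_image.1 hd
      obtain ⟨rfl, rfl⟩ := Prod.mk.inj hcd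
      rw [Equiv.Perm.mul_apply, Equiv.Perm.inv_eq_iff_eq, Equiv.Perm.mul_apply, hdc]
    have := mul_mem (mul_mem huH hh) this
    rwa [mul_inv_cancel_left] at this

/-- For an oligomorphic group, weak elimination of imaginaries quantifies over countably many data
only. -/
theorem weakEI_iff {G : Subgroup (Equiv.Perm ℕ)} (hG : IsOligomorphic G) :
    WeakEI G ↔ ∀ C F, IsSubgroupCode G C F →
      ∃ K, IsSupport G C F K ∧ ∀ K', IsSupport G C F K' → K ⊆ K' := by
  classical
  have key : ∀ {H : Subgroup (Equiv.Perm ℕ)} {C F},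
      (∀ g, g ∈ H ↔ g ∈ G ∧ InDoubleCosets G C F g) → ∀ K : Finset ℕ,
      IsSupport G C F K ↔ (K : Set ℕ) ∈ {K : Set ℕ | K.Finite ∧ acl G K = K ∧
        ptStab G K ≤ H ∧ H ≤ setStab G K} := by
    intro H C F hH K
    have h1 : ptStab G K ≤ H ↔ ∀ g ∈ G, (∀ a ∈ K, g a = a) → InDoubleCosets G C F g :=
      ⟨fun h g hg hgK => ((hH g).1 (h (mem_ptStab.2 ⟨hg, hgK⟩))).2,
        fun h g hg => (hH g).2 ⟨(mem_ptStab.1 hg).1, h g (mem_ptStab.1 hg).1 (mem_ptStab.1 hg).2⟩⟩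
    have h2 : H ≤ setStab G K ↔ ∀ g ∈ G, InDoubleCosets G C F g → ∀ a ∈ K, g a ∈ K :=
      ⟨fun h g hg hgK => ((mem_setStab_of_finite K.finite_toSet).1 (h ((hH g).2 ⟨hg, hgK⟩))).2,
        fun h g hg => (mem_setStab_of_finite K.finite_toSet).2
          ⟨((hH g).1 hg).1, h g ((hH g).1 hg).1 ((hH g).1 hg).2⟩⟩
    rw [Set.mem_ofPred_eq, h1, h2, IsSupport]
    exact ⟨fun h => ⟨K.finite_toSet, h⟩, fun h => h.2⟩
  constructor
  · rintro hW C F ⟨hone, hdiv⟩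
    have hinv : ∀ g ∈ G, InDoubleCosets G C F g → InDoubleCosets G C F g⁻¹ := fun g hg h =>
      hdiv g⁻¹ (inv_mem hg) g hg h (by simpa using hone)
    let H : Subgroup (Equiv.Perm ℕ) :=
      { carrier := {g | g ∈ G ∧ InDoubleCosets G C F g}
        mul_mem' := fun {g h} hg hh => ⟨mul_mem hg.1 hh.1,
          hdiv _ (mul_mem hg.1 hh.1) g⁻¹ (inv_mem hg.1) (hinv g hg.1 hg.2) (by simpa using hh.2)⟩
        one_mem' := ⟨one_mem G, hone⟩
        inv_mem' := fun {g} hg => ⟨inv_mem hg.1, hinv g hg.1 hg.2⟩ }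
    have hH : ∀ g, g ∈ H ↔ g ∈ G ∧ InDoubleCosets G C F g := fun g => Iff.rfl
    obtain ⟨K, hK, hmin⟩ := hW H (fun g hg => hg.1) ⟨C, C.finite_toSet, fun g hg =>
      ⟨(mem_ptStab.1 hg).1, hone.congr fun c hc => ((mem_ptStab.1 hg).2 c hc).symm⟩⟩
    obtain ⟨K, rfl⟩ := hK.1.exists_finset_coe
    exact ⟨K, (key hH K).2 hK, fun K' hK' => Finset.coe_subset.1 (hmin ((key hH K').1 hK'))⟩
  · rintro h H hHG ⟨C, hfin, hC⟩
    obtain ⟨C, rfl⟩ := hfin.exists_finset_coe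
    obtain ⟨F, hF⟩ := exists_inDoubleCosets hG hHG hC
    obtain ⟨K, hK, hmin⟩ := h C F ⟨((hF 1).1 (one_mem H)).2, fun h hh g hg hg1 hg2 =>
      ((hF h).1 (by
        have := mul_mem (inv_mem ((hF g).2 ⟨hg, hg1⟩)) ((hF _).2 ⟨mul_mem hg hh, hg2⟩)
        simpa using this)).2⟩
    refine ⟨K, (key hF K).1 hK, fun K' hK' => ?_⟩
    obtain ⟨K', rfl⟩ := (show K'.Finite from hK'.1).exists_finset_coe
    exact Finset.coe_subset.2 (hmin K' ((key hF K').2 hK'))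

theorem measurableSet_autOmegaCatWEI : MeasurableSet autOmegaCatWEI := by
  have : autOmegaCatWEI = oligomorphicGroups ∩ {G | ∀ C F, IsSubgroupCode G.toSubgroup C F →
      ∃ K, IsSupport G.toSubgroup C F K ∧ ∀ K', IsSupport G.toSubgroup C F K' → K ⊆ K'} := by
    rw [autOmegaCatWEI_eq]
    ext G
    exact and_congr_right fun hG => weakEI_iff hG
  rw [this]
  exact measurableSet_oligomorphicGroups.inter <| measurableSet_forall fun C =>
    measurableSet_forall fun F => measurableSet_imp (measurableSet_isSubgroupCode C F) <|
      measurableSet_exists fun K => (measurableSet_isSupport C F K).inter <|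
        measurableSet_forall fun K' =>
          measurableSet_imp (measurableSet_isSupport C F K') (MeasurableSet.const _)

/-! ### The structure of cosets of stabilizers of closed sets -/

/-- The relation symbols of the language of cosets: an inclusion and a product. -/
inductive CosetRel : ℕ → Type
  | le : CosetRel 2
  | mul : CosetRel 3

/-- The language with a binary relation `le` and a ternary relation `mul`. -/
def cosetLanguage : FirstOrder.Language.{0, 0} := ⟨fun _ => Empty, CosetRel⟩

theorem countable_cosetLanguage : Countable cosetLanguage.Symbols := by
  have (n : ℕ) : Countable (cosetLanguage.Functions n) := inferInstanceAs (Countable Empty)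
  have (n : ℕ) : Countable (CosetRel n) := by
    refine Function.Injective.countable (f := fun _ : CosetRel n => ()) fun a b _ => ?_
    cases a <;> cases b <;> rfl
  have (n : ℕ) : Countable (cosetLanguage.Relations n) := inferInstanceAs (Countable (CosetRel n))
  exact inferInstanceAs (Countable (_ ⊕ _))

/-- The graph of the restriction of `g` to `K`. -/
def restr (g : Equiv.Perm ℕ) (K : Finset ℕ) : Finset (ℕ × ℕ) := K.image fun x => (x, g x)

theorem mem_restr {g : Equiv.Perm ℕ} {K : Finset ℕ} {x y : ℕ} :
    (x, y) ∈ restr g K ↔ x ∈ K ∧ g x = y := by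
  simp only [restr, Finset.mem_image, Prod.mk.injEq]
  constructor
  · rintro ⟨a, ha, rfl, rfl⟩
    exact ⟨ha, rfl⟩
  · rintro ⟨hx, rfl⟩
    exact ⟨x, hx, rfl, rfl⟩

/-- The graphs of the restrictions of the members of `G` to the finite algebraically closed sets.
The graph of `g` on `K` stands for the coset `g G_(K)`, the set of its extensions in `G`. -/
def restrictions (G : Subgroup (Equiv.Perm ℕ)) : Set (Finset (ℕ × ℕ)) :=
  {p | ∃ K : Finset ℕ, acl G K = K ∧ ∃ g ∈ G, p = restr g K}

/-- The relation `r ⊆ p ∘ q`, which says of the cosets that `p` and `q` stand for that their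
product is contained in the one of `r`. -/
def SubComp (p q r : Finset (ℕ × ℕ)) : Prop :=
  ∀ x z, (x, z) ∈ r → ∃ y, (x, y) ∈ q ∧ (y, z) ∈ p

instance (G : Subgroup (Equiv.Perm ℕ)) : cosetLanguage.Structure (restrictions G) where
  funMap f := f.elim
  RelMap R x := match R, x with
    | CosetRel.le, x => (x 0).1 ⊆ (x 1).1
    | CosetRel.mul, x => SubComp (x 0).1 (x 1).1 (x 2).1

theorem map_le_iff {G H : Subgroup (Equiv.Perm ℕ)}
    (Φ : restrictions G ≃[cosetLanguage] restrictions H) (p q : restrictions G) :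
    (Φ p).1 ⊆ (Φ q).1 ↔ p.1 ⊆ q.1 :=
  Φ.map_rel' (CosetRel.le : cosetLanguage.Relations 2) ![p, q]

theorem map_subComp_iff {G H : Subgroup (Equiv.Perm ℕ)}
    (Φ : restrictions G ≃[cosetLanguage] restrictions H) (p q r : restrictions G) :
    SubComp (Φ p).1 (Φ q).1 (Φ r).1 ↔ SubComp p.1 q.1 r.1 :=
  Φ.map_rel' (CosetRel.mul : cosetLanguage.Relations 3) ![p, q, r]

/-- A bijection that preserves inclusion and products, as an isomorphism. -/
def restrictionsEquiv {G H : Subgroup (Equiv.Perm ℕ)} (e : restrictions G ≃ restrictions H)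
    (hle : ∀ p q, (e p).1 ⊆ (e q).1 ↔ p.1 ⊆ q.1)
    (hmul : ∀ p q r, SubComp (e p).1 (e q).1 (e r).1 ↔ SubComp p.1 q.1 r.1) :
    restrictions G ≃[cosetLanguage] restrictions H where
  toEquiv := e
  map_fun' f := f.elim
  map_rel' R x := match R, x with
    | CosetRel.le, x => hle (x 0) (x 1)
    | CosetRel.mul, x => hmul (x 0) (x 1) (x 2)

section Atomic

variable {G : Subgroup (Equiv.Perm ℕ)}

theorem acl_image_finset {g : Equiv.Perm ℕ} (hg : g ∈ G) {K : Finset ℕ}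
    (hK : acl G K = K) : acl G (K.image g : Finset ℕ) = (K.image g : Finset ℕ) := by
  rw [Finset.coe_image, acl_image hg, hK]

/-- The image of a set of pairs under a permutation that acts on both coordinates. -/
def conj (g : Equiv.Perm ℕ) (p : Finset (ℕ × ℕ)) : Finset (ℕ × ℕ) :=
  p.map (g.prodCongr g).toEmbedding

theorem mem_conj {g : Equiv.Perm ℕ} {p : Finset (ℕ × ℕ)} {x y : ℕ} :
    (g x, g y) ∈ conj g p ↔ (x, y) ∈ p :=
  Finset.mem_map' (g.prodCongr g).toEmbedding (a := (x, y))

theorem conj_conj (g h : Equiv.Perm ℕ) (p : Finset (ℕ × ℕ)) :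
    conj g (conj h p) = conj (g * h) p := by
  simp only [conj, Finset.map_map]
  rfl

theorem conj_one (p : Finset (ℕ × ℕ)) : conj 1 p = p :=
  Finset.map_refl

theorem conj_mem_restrictions {g : Equiv.Perm ℕ} (hg : g ∈ G) {p : Finset (ℕ × ℕ)}
    (hp : p ∈ restrictions G) : conj g p ∈ restrictions G := by
  obtain ⟨K, hK, h, hh, rfl⟩ := hp
  refine ⟨K.image g, acl_image_finset hg hK, g * h * g⁻¹, mul_mem (mul_mem hg hh) (inv_mem hg), ?_⟩
  ext ⟨x, y⟩
  obtain ⟨x, rfl⟩ := g.surjective x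
  obtain ⟨y, rfl⟩ := g.surjective y
  rw [mem_conj, mem_restr, mem_restr]
  simp

/-- Conjugation by a member of `G`, as an automorphism. -/
def conjEquiv {g : Equiv.Perm ℕ} (hg : g ∈ G) :
    restrictions G ≃[cosetLanguage] restrictions G :=
  restrictionsEquiv
    { toFun := fun p => ⟨conj g p, conj_mem_restrictions hg p.2⟩
      invFun := fun p => ⟨conj g⁻¹ p, conj_mem_restrictions (inv_mem hg) p.2⟩
      left_inv := fun p => by simp [conj_conj, conj_one]
      right_inv := fun p => by simp [conj_conj, conj_one] }
    (fun p q => Finset.map_subset_map)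
    (fun p q r => by
      constructor
      · intro h x z hxz
        obtain ⟨y, h1, h2⟩ := h (g x) (g z) (mem_conj.2 hxz)
        obtain ⟨y, rfl⟩ := g.surjective y
        exact ⟨y, mem_conj.1 h1, mem_conj.1 h2⟩
      · intro h x z hxz
        obtain ⟨x, rfl⟩ := g.surjective x
        obtain ⟨z, rfl⟩ := g.surjective z
        obtain ⟨y, h1, h2⟩ := h x z (mem_conj.1 hxz)
        exact ⟨g y, mem_conj.2 h1, mem_conj.2 h2⟩)

/-- The height of `p` in the structure of cosets is less than `m`: every chain `p₀ ⊂ ⋯ ⊂ pₖ = p`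
has `k < m`. -/
def HeightLT (G : Subgroup (Equiv.Perm ℕ)) : ℕ → restrictions G → Prop
  | 0, _ => False
  | m + 1, p => ∀ q : restrictions G, q.1 ⊂ p.1 → HeightLT G m q

theorem exists_formula_heightLT (m : ℕ) : ∃ φ : cosetLanguage.Formula Unit,
    ∀ p : restrictions G, φ.Realize (fun _ => p) ↔ HeightLT G m p := by
  induction m with
  | zero => exact ⟨⊥, fun p => by simp [HeightLT]⟩
  | succ m ih =>
    obtain ⟨φ, hφ⟩ := ih
    let R : cosetLanguage.Relations 2 := CosetRel.le
    let le (i j : Unit ⊕ Unit) : cosetLanguage.Formula (Unit ⊕ Unit) :=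
      R.formula₂ (Term.var i) (Term.var j)
    have hle : ∀ (i j : Unit ⊕ Unit) (v : Unit ⊕ Unit → restrictions G),
        (le i j).Realize v ↔ (v i).1 ⊆ (v j).1 := by
      intro i j v
      simp only [le, Formula.realize_rel₂, Term.realize_var]
      rfl
    refine ⟨Formula.iAlls Unit ((le (.inr ()) (.inl ()) ⊓ (le (.inl ()) (.inr ())).not).imp
      (φ.relabel Sum.inr)), fun p => ?_⟩
    simp only [Formula.realize_iAlls, Formula.realize_imp, Formula.realize_inf, hle,
      Formula.realize_not, Formula.realize_relabel, HeightLT]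
    constructor
    · intro h q hq
      exact (hφ q).1 (h (fun _ => q) ⟨hq.1, hq.2⟩)
    · intro h i hi
      exact (hφ (i ())).2 (h (i ()) ⟨hi.1, hi.2⟩)

theorem heightLT_of_card_lt {m : ℕ} {p : restrictions G} (h : p.1.card < m) : HeightLT G m p := by
  induction m generalizing p with
  | zero => exact absurd h (Nat.not_lt_zero _)
  | succ m ih =>
    exact fun q hq => ih (lt_of_lt_of_le (Finset.card_lt_card hq) (Nat.lt_succ_iff.1 h))

theorem restr_subset {g : Equiv.Perm ℕ} {K K' : Finset ℕ} (h : K ⊆ K') : restr g K ⊆ restr g K' :=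
  Finset.image_subset_image h

/-- A chain of closed subsets of `K` restricts `g` to a chain below `restr g K`, so that a bound on
the height of `restr g K` bounds the number of points that generate `K`. -/
theorem exists_generators_of_heightLT {m : ℕ} {g : Equiv.Perm ℕ} (hg : g ∈ G) {K : Finset ℕ}
    (hK : acl G K = K) (h : HeightLT G m ⟨restr g K, K, hK, g, hg, rfl⟩) :
    ∃ A : Finset ℕ, A.card ≤ m ∧ acl G A = K := by
  classical
  induction m generalizing K with
  | zero => exact h.elim
  | succ m ih =>
    by_cases hex : ∃ K' : Finset ℕ, acl G K' = K' ∧ K' ⊂ K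
    · -- take a maximal closed proper subset and add one point outside of it
      let S : Finset (Finset ℕ) := K.powerset.filter fun K' : Finset ℕ => acl G K' = K' ∧ K' ⊂ K
      have hS : S.Nonempty := by
        obtain ⟨K', h1, h2⟩ := hex
        exact ⟨K', Finset.mem_filter.2 ⟨Finset.mem_powerset.2 h2.1, h1, h2⟩⟩
      obtain ⟨K', hK'S, hmax⟩ := S.exists_maximal hS
      obtain ⟨-, hK', hK'K⟩ := Finset.mem_filter.1 hK'S
      obtain ⟨A, hA, hAK⟩ := ih hK' (h ⟨restr g K', K', hK', g, hg, rfl⟩ (by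
        refine ⟨restr_subset hK'K.1, fun hsub => hK'K.2 fun x hx => ?_⟩
        exact (mem_restr.1 (hsub (mem_restr.2 ⟨hx, rfl⟩))).1))
      obtain ⟨a, haK, haK'⟩ := Finset.exists_of_ssubset hK'K
      refine ⟨insert a A, (Finset.card_insert_le _ _).trans (by omega), ?_⟩
      have hAsub : ((insert a A : Finset ℕ) : Set ℕ) ⊆ K := by
        intro x hx
        rcases Finset.mem_insert.1 hx with rfl | hx
        · exact haK
        · exact hK'K.1 (Finset.mem_coe.1 (hAK ▸ subset_acl _ hx))
      have hsub : acl G (insert a A : Finset ℕ) ⊆ K := hK ▸ acl_mono hAsub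
      obtain ⟨K'', hK''⟩ := (K.finite_toSet.subset hsub).exists_finset_coe
      rw [← hK''] at hsub ⊢
      have hcl : acl G K'' = K'' := by
        rw [hK'']
        exact acl_acl (hK'' ▸ K''.finite_toSet)
      have hK'sub : K' ⊆ K'' := by
        rw [← Finset.coe_subset, hK'', ← hAK]
        exact acl_mono (by simp)
      have haK'' : a ∈ K'' := by
        rw [← Finset.mem_coe, hK'']
        exact subset_acl _ (by simp)
      by_contra hne
      have hss : K'' ⊂ K := (Finset.coe_subset.1 hsub).ssubset_of_ne fun h => hne (by rw [h])
      exact haK' (hmax (Finset.mem_filter.2 ⟨Finset.mem_powerset.2 hss.1, hcl, hss⟩) hK'sub haK'')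
    · refine ⟨∅, Nat.zero_le _, ?_⟩
      push Not at hex
      have hsub : acl G (∅ : Finset ℕ) ⊆ K := hK ▸ acl_mono (by simp)
      obtain ⟨K'', hK''⟩ := (K.finite_toSet.subset hsub).exists_finset_coe
      rw [← hK''] at hsub ⊢
      have hcl : acl G K'' = K'' := by
        rw [hK'']
        exact acl_acl (hK'' ▸ K''.finite_toSet)
      by_contra hne
      exact hex K'' hcl ((Finset.coe_subset.1 hsub).ssubset_of_ne fun h => hne (by rw [h]))

/-- The algebraic closures of sets of bounded size have bounded size. -/
theorem IsOligomorphic.exists_card_le (hG : IsOligomorphic G) (m : ℕ) :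
    ∃ N, ∀ A K : Finset ℕ, A.card ≤ m → acl G A = K → K.card ≤ N := by
  obtain ⟨X, hX⟩ := hG.exists_finset m
  refine ⟨(hG.finite_acl X.finite_toSet).toFinset.card, fun A K hA hAK => ?_⟩
  obtain ⟨g, hg, hgX⟩ := hX A hA
  rw [← Finset.card_image_of_injective K g.injective]
  refine Finset.card_le_card fun x hx => ?_
  rw [Set.Finite.mem_toFinset]
  obtain ⟨y, hy, rfl⟩ := Finset.mem_image.1 hx
  have : g y ∈ acl G (g '' A) := by
    rw [acl_image hg, hAK]
    exact Set.mem_image_of_mem g hy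
  refine acl_mono ?_ this
  rintro _ ⟨z, hz, rfl⟩
  exact hgX z hz

/-- There are finitely many tuples of bounded height up to conjugation: all of them can be moved
into a fixed finite set. -/
theorem IsOligomorphic.exists_conj_subset (hG : IsOligomorphic G) (n m : ℕ) :
    ∃ X : Finset ℕ, ∀ b : Fin n → restrictions G, (∀ i, HeightLT G m (b i)) →
      ∃ g ∈ G, ∀ i, conj g (b i) ⊆ X ×ˢ X := by
  classical
  obtain ⟨N, hN⟩ := hG.exists_card_le m
  obtain ⟨X, hX⟩ := hG.exists_finset (n * (N + N))
  refine ⟨X, fun b hb => ?_⟩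
  choose K hK h hh hbK using fun i => (b i).2
  have hcard : ∀ i, (K i).card ≤ N := by
    intro i
    obtain ⟨A, hA, hAK⟩ := exists_generators_of_heightLT (hh i) (hK i) (m := m) (by
      have := hb i
      rwa [show b i = ⟨restr (h i) (K i), _⟩ from Subtype.ext (hbK i)] at this)
    exact hN A _ hA hAK
  obtain ⟨g, hg, hgX⟩ := hX (Finset.univ.biUnion fun i => K i ∪ (K i).image (h i)) (by
    refine Finset.card_biUnion_le.trans ((Finset.sum_le_card_nsmul _ _ (N + N) fun i _ => ?_).trans
      (by simp))
    exact (Finset.card_union_le _ _).trans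
      (add_le_add (hcard i) (Finset.card_image_le.trans (hcard i))))
  refine ⟨g, hg, fun i => ?_⟩
  rintro ⟨x, y⟩ hxy
  obtain ⟨x, rfl⟩ := g.surjective x
  obtain ⟨y, rfl⟩ := g.surjective y
  rw [mem_conj, hbK i, mem_restr] at hxy
  refine Finset.mem_product.2 ⟨hgX x ?_, hgX y ?_⟩
  · exact Finset.mem_biUnion.2 ⟨i, Finset.mem_univ i, Finset.mem_union_left _ hxy.1⟩
  · exact Finset.mem_biUnion.2 ⟨i, Finset.mem_univ i,
      Finset.mem_union_right _ (hxy.2 ▸ Finset.mem_image_of_mem _ hxy.1)⟩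

theorem isAtomic_restrictions (hG : IsOligomorphic G) :
    IsAtomic cosetLanguage (restrictions G) := by
  classical
  intro n a
  obtain ⟨m, hm⟩ := (Finset.univ.image fun i => (a i).1.card).bddAbove
  obtain ⟨φ, hφ⟩ := exists_formula_heightLT (G := G) (m + 1)
  obtain ⟨X, hX⟩ := hG.exists_conj_subset n (m + 1)
  have hχ : ∀ b : Fin n → restrictions G,
      (Formula.iInf fun i : Fin n => φ.relabel fun _ => i).Realize b ↔
        ∀ i, HeightLT G (m + 1) (b i) := by
    intro b
    rw [Formula.realize_iInf]
    refine forall_congr' fun i => ?_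
    rw [Formula.realize_relabel, ← hφ]
    rfl
  have hfin : {q : restrictions G | q.1 ⊆ X ×ˢ X}.Finite :=
    Set.Finite.of_finite_image (f := Subtype.val) ((X ×ˢ X).powerset.finite_toSet.subset (by
      rintro _ ⟨q, hq, rfl⟩
      exact Finset.mem_coe.2 (Finset.mem_powerset.2 hq))) Subtype.val_injective.injOn
  refine exists_isolates_of_finite (χ := Formula.iInf fun i : Fin n => φ.relabel fun _ => i)
    ((hχ a).2 fun i => heightLT_of_card_lt (Nat.lt_succ_iff.2
      (hm (Finset.mem_coe.2 (Finset.mem_image_of_mem _ (Finset.mem_univ i))))))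
    (Set.Finite.pi' (fun _ : Fin n => hfin)) fun b hb => ?_
  obtain ⟨g, hg, hgX⟩ := hX b ((hχ b).1 hb)
  exact ⟨conjEquiv hg ∘ b, hgX, (sameType_of_equiv (conjEquiv hg) b).symm⟩

end Atomic

/-! ### From topological isomorphisms to isomorphisms of coset structures -/

/-- The permutation `g` extends the partial map with graph `p`. -/
def Extends (p : Finset (ℕ × ℕ)) (g : Equiv.Perm ℕ) : Prop := ∀ x y, (x, y) ∈ p → g x = y

theorem extends_restr {g h : Equiv.Perm ℕ} {K : Finset ℕ} :
    Extends (restr g K) h ↔ ∀ x ∈ K, h x = g x := by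
  constructor
  · exact fun H x hx => H x _ (mem_restr.2 ⟨hx, rfl⟩)
  · intro H x y hxy
    obtain ⟨hx, rfl⟩ := mem_restr.1 hxy
    exact H x hx

theorem extends_restr_iff_mem {G : Subgroup (Equiv.Perm ℕ)} {g h : Equiv.Perm ℕ} (hg : g ∈ G)
    (hh : h ∈ G) {K : Finset ℕ} : Extends (restr g K) h ↔ g⁻¹ * h ∈ ptStab G K := by
  rw [extends_restr, mem_ptStab, and_iff_right (mul_mem (inv_mem hg) hh)]
  refine forall₂_congr fun x _ => ?_
  rw [Equiv.Perm.mul_apply, Equiv.Perm.inv_eq_iff_eq]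

section Cosets

variable {G : Subgroup (Equiv.Perm ℕ)}

/-- An inclusion of restrictions is an inclusion of the corresponding cosets. -/
theorem subset_iff_extends {p q : Finset (ℕ × ℕ)} (hp : p ∈ restrictions G)
    (hq : q ∈ restrictions G) : p ⊆ q ↔ ∀ g ∈ G, Extends q g → Extends p g := by
  refine ⟨fun h g _ hg x y hxy => hg x y (h hxy), fun h => ?_⟩
  obtain ⟨K, hK, g, hg, rfl⟩ := hp
  obtain ⟨K', hK', g', hg', rfl⟩ := hq
  rintro ⟨x, y⟩ hxy
  obtain ⟨hx, rfl⟩ := mem_restr.1 hxy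
  have key : ∀ u ∈ ptStab G K', g' (u x) = g x := fun u hu =>
    extends_restr.1 (h (g' * u) (mul_mem hg' (mem_ptStab.1 hu).1) (extends_restr.2 fun a ha => by
      rw [Equiv.Perm.mul_apply, (mem_ptStab.1 hu).2 a ha])) x hx
  have hone := key 1 (one_mem _)
  refine mem_restr.2 ⟨mem_of_forall_fixed hK' fun u hu => ?_, hone⟩
  exact g'.injective ((key u hu).trans hone.symm)

/-- The product relation on restrictions is an inclusion of products of the corresponding cosets. -/
theorem subComp_iff_extends {p q r : Finset (ℕ × ℕ)} (hp : p ∈ restrictions G)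
    (hq : q ∈ restrictions G) : SubComp p q r ↔
      ∀ g ∈ G, ∀ h ∈ G, Extends p g → Extends q h → Extends r (g * h) := by
  constructor
  · intro H g _ h _ hg hh x z hxz
    obtain ⟨y, hxy, hyz⟩ := H x z hxz
    rw [Equiv.Perm.mul_apply, hh x y hxy, hg y z hyz]
  intro H
  obtain ⟨K, hK, g, hg, rfl⟩ := hp
  obtain ⟨L, hL, h, hh, rfl⟩ := hq
  -- multiplying `g` and `h` on the right by members of the stabilizers of their domains does not
  -- change the product on the domain of `r`
  have key : ∀ u ∈ ptStab G K, ∀ v ∈ ptStab G L, ∀ x z, (x, z) ∈ r → g (u (h (v x))) = z := by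
    intro u hu v hv
    refine H (g * u) (mul_mem hg (mem_ptStab.1 hu).1) (h * v) (mul_mem hh (mem_ptStab.1 hv).1)
      (extends_restr.2 fun a ha => ?_) (extends_restr.2 fun a ha => ?_)
    · rw [Equiv.Perm.mul_apply, (mem_ptStab.1 hu).2 a ha]
    · rw [Equiv.Perm.mul_apply, (mem_ptStab.1 hv).2 a ha]
  intro x z hxz
  have hone : g (h x) = z := key 1 (one_mem _) 1 (one_mem _) x z hxz
  refine ⟨h x, mem_restr.2 ⟨mem_of_forall_fixed hL fun v hv => ?_, rfl⟩,
    mem_restr.2 ⟨mem_of_forall_fixed hK fun u hu => ?_, hone⟩⟩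
  · exact h.injective (g.injective ((key 1 (one_mem _) v hv x z hxz).trans hone.symm))
  · exact g.injective ((key u hu 1 (one_mem _) x z hxz).trans hone.symm)

end Cosets

theorem exists_finset_symm_mem_ptStab {G H : ClosedSubgroup (Equiv.Perm ℕ)}
    (α : G.toSubgroup ≃ₜ* H.toSubgroup) (K : Finset ℕ) :
    ∃ C : Finset ℕ, ∀ h : H.toSubgroup, (∀ a ∈ C, h.1 a = a) →
      (α.symm h).1 ∈ ptStab G.toSubgroup K := by
  have hopen : IsOpen {h : H.toSubgroup | ∀ a ∈ K, (α.symm h).1 a = id a} :=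
    (isOpen_agree K id).preimage (continuous_subtype_val.comp α.symm.continuous)
  obtain ⟨U, hU, hUeq⟩ := isOpen_induced_iff.1 hopen
  have h1 : (1 : H.toSubgroup) ∈ Subtype.val ⁻¹' U := by
    rw [hUeq]
    simp
  obtain ⟨C, hC⟩ := exists_finset_of_isOpen hU (g := 1) h1
  refine ⟨C, fun h hh => mem_ptStab.2 ⟨(α.symm h).2, ?_⟩⟩
  have : h ∈ Subtype.val ⁻¹' U := hC h.1 hh
  rw [hUeq] at this
  exact this

/-- A topological isomorphism takes the pointwise stabilizers of the finite closed sets to each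
other: among the open subgroups, they are the ones without a proper open subgroup of finite
index. -/
theorem exists_ptStab_image {G H : ClosedSubgroup (Equiv.Perm ℕ)} (hG : WeakEI G.toSubgroup)
    (hH : WeakEI H.toSubgroup) (α : G.toSubgroup ≃ₜ* H.toSubgroup) {K : Finset ℕ}
    (hK : acl G.toSubgroup K = K) : ∃ L : Finset ℕ, acl H.toSubgroup L = L ∧
      ∀ g : G.toSubgroup, g.1 ∈ ptStab G.toSubgroup K ↔ (α g).1 ∈ ptStab H.toSubgroup L := by
  -- `V` is the image of the stabilizer of `K`
  let V : Subgroup (Equiv.Perm ℕ) :=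
    (((ptStab G.toSubgroup K).subgroupOf G.toSubgroup).map α.toMonoidHom).map H.toSubgroup.subtype
  have hV : ∀ g : G.toSubgroup, (α g).1 ∈ V ↔ g.1 ∈ ptStab G.toSubgroup K := by
    intro g
    constructor
    · rintro ⟨_, ⟨g', hg', rfl⟩, h⟩
      obtain rfl : g' = g := α.injective (Subtype.ext h)
      exact hg'
    · exact fun h => ⟨α g, ⟨g, h, rfl⟩, rfl⟩
  have hVH : V ≤ H.toSubgroup := by
    rintro _ ⟨h, -, rfl⟩
    exact h.2
  obtain ⟨C, hC⟩ := exists_finset_symm_mem_ptStab α K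
  obtain ⟨L, hL, -⟩ := hH V hVH ⟨C, C.finite_toSet, fun h hh => by
    have := (hV _).2 (hC ⟨h, (mem_ptStab.1 hh).1⟩ (mem_ptStab.1 hh).2)
    simpa using this⟩
  obtain ⟨hLfin, hLacl, hLV, hVL⟩ := hL
  obtain ⟨L, rfl⟩ := hLfin.exists_finset_coe
  refine ⟨L, hLacl, fun g => ⟨fun hg => ?_, fun hg => (hV g).1 (hLV hg)⟩⟩
  -- `U` is the preimage of the stabilizer of `L`, a subgroup of finite index of the stabilizer
  -- of `K`
  let U : Subgroup (Equiv.Perm ℕ) :=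
    (((ptStab H.toSubgroup L).subgroupOf H.toSubgroup).comap α.toMonoidHom).map G.toSubgroup.subtype
  have hU : ∀ g : G.toSubgroup, g.1 ∈ U ↔ (α g).1 ∈ ptStab H.toSubgroup L := by
    intro g
    constructor
    · rintro ⟨g', hg', h⟩
      obtain rfl : g' = g := Subtype.ext h
      exact hg'
    · exact fun h => ⟨g, h, rfl⟩
  have hUG : U ≤ G.toSubgroup := by
    rintro _ ⟨g, -, rfl⟩
    exact g.2
  obtain ⟨C', hC'⟩ := exists_finset_symm_mem_ptStab α.symm L
  obtain ⟨K', ⟨hK'fin, hK'acl, hK'U, hUK'⟩, -⟩ := hG U hUG ⟨C', C'.finite_toSet, fun g hg =>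
    (hU ⟨g, (mem_ptStab.1 hg).1⟩).2 (hC' ⟨g, (mem_ptStab.1 hg).1⟩ (mem_ptStab.1 hg).2)⟩
  have hVmem : ∀ v ∈ ptStab G.toSubgroup K, ∀ hv : v ∈ G.toSubgroup, ∀ a ∈ L,
      (α ⟨v, hv⟩).1 a ∈ L := fun v hv hvG =>
    ((mem_setStab_of_finite L.finite_toSet).1 (hVL ((hV ⟨v, hvG⟩).2 hv))).2
  have hsub : K' ⊆ K := by
    intro x hx
    rw [← hK]
    refine mem_acl_iff.2 (exists_finite_of_finite_cosets
      (fun (v : ptStab G.toSubgroup K) (a : L) =>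
        (⟨(α ⟨v.1, (mem_ptStab.1 v.2).1⟩).1 a, hVmem v.1 v.2 _ a a.2⟩ : L)) hK'fin
      fun v w hvw => ?_)
    let v' : G.toSubgroup := ⟨v.1, (mem_ptStab.1 v.2).1⟩
    let w' : G.toSubgroup := ⟨w.1, (mem_ptStab.1 w.2).1⟩
    have hmem : (w'⁻¹ * v').1 ∈ U := by
      rw [hU, map_mul, map_inv]
      refine mem_ptStab.2 ⟨((α w')⁻¹ * α v').2, fun a ha => ?_⟩
      change ((α w').1⁻¹ : Equiv.Perm ℕ) ((α v').1 a) = a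
      rw [Equiv.Perm.inv_eq_iff_eq]
      exact congrArg Subtype.val (congrFun hvw ⟨a, ha⟩)
    exact ((mem_setStab_of_finite hK'fin).1 (hUK' hmem)).2 x hx
  exact (hU g).1 (hK'U (ptStab_anti hsub hg))

theorem exists_restriction_image {G H : ClosedSubgroup (Equiv.Perm ℕ)} (hG : WeakEI G.toSubgroup)
    (hH : WeakEI H.toSubgroup) (α : G.toSubgroup ≃ₜ* H.toSubgroup)
    (p : restrictions G.toSubgroup) : ∃ q : restrictions H.toSubgroup,
      ∀ g : G.toSubgroup, Extends p g.1 ↔ Extends q (α g).1 := by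
  obtain ⟨_, K, hK, g, hg, rfl⟩ := p
  obtain ⟨L, hL, h⟩ := exists_ptStab_image hG hH α hK
  refine ⟨⟨restr (α ⟨g, hg⟩).1 L, L, hL, _, (α ⟨g, hg⟩).2, rfl⟩, fun g' => ?_⟩
  rw [extends_restr_iff_mem hg g'.2, extends_restr_iff_mem (α ⟨g, hg⟩).2 (α g').2]
  have := h (⟨g, hg⟩⁻¹ * g')
  rwa [map_mul, map_inv] at this

theorem nonempty_restrictions_equiv_of_topIso {G H : ClosedSubgroup (Equiv.Perm ℕ)}
    (hG : WeakEI G.toSubgroup) (hH : WeakEI H.toSubgroup) (h : TopIso G H) :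
    Nonempty (restrictions G.toSubgroup ≃[cosetLanguage] restrictions H.toSubgroup) := by
  obtain ⟨α⟩ := h
  choose e he using exists_restriction_image hG hH α
  choose e' he' using exists_restriction_image hH hG α.symm
  have heG : ∀ p, ∀ g ∈ G.toSubgroup, Extends (e' (e p)).1 g ↔ Extends p.1 g := by
    intro p g hg
    have := he' (e p) (α ⟨g, hg⟩)
    rw [ContinuousMulEquiv.symm_apply_apply] at this
    exact this.symm.trans (he p ⟨g, hg⟩).symm
  have heH : ∀ q, ∀ h ∈ H.toSubgroup, Extends (e (e' q)).1 h ↔ Extends q.1 h := by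
    intro q h hh
    have := he (e' q) (α.symm ⟨h, hh⟩)
    rw [ContinuousMulEquiv.apply_symm_apply] at this
    exact this.symm.trans (he' q ⟨h, hh⟩).symm
  have hforall : ∀ P : Equiv.Perm ℕ → Prop, (∀ h ∈ H.toSubgroup, P h) ↔
      ∀ g : G.toSubgroup, P (α g).1 := fun P =>
    ⟨fun h g => h _ (α g).2, fun h k hk => by simpa using h (α.symm ⟨k, hk⟩)⟩
  refine ⟨restrictionsEquiv ⟨e, e', fun p => ?_, fun q => ?_⟩ (fun p q => ?_) (fun p q r => ?_)⟩
  · refine Subtype.ext (Finset.Subset.antisymm ?_ ?_)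
    · exact (subset_iff_extends (e' (e p)).2 p.2).2 fun g hg => (heG p g hg).2
    · exact (subset_iff_extends p.2 (e' (e p)).2).2 fun g hg => (heG p g hg).1
  · refine Subtype.ext (Finset.Subset.antisymm ?_ ?_)
    · exact (subset_iff_extends (e (e' q)).2 q.2).2 fun g hg => (heH q g hg).2
    · exact (subset_iff_extends q.2 (e (e' q)).2).2 fun g hg => (heH q g hg).1
  · change (e p).1 ⊆ (e q).1 ↔ _
    rw [subset_iff_extends (e p).2 (e q).2, subset_iff_extends p.2 q.2, hforall]
    simp only [← he]
    exact ⟨fun h g hg => h ⟨g, hg⟩, fun h g => h g.1 g.2⟩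
  · change SubComp (e p).1 (e q).1 (e r).1 ↔ _
    rw [subComp_iff_extends (e p).2 (e q).2, subComp_iff_extends p.2 q.2, hforall]
    have : ∀ g : G.toSubgroup, (∀ h ∈ H.toSubgroup, Extends (e p).1 (α g).1 → Extends (e q).1 h →
        Extends (e r).1 ((α g).1 * h)) ↔ ∀ h : G.toSubgroup, Extends p.1 g.1 → Extends q.1 h.1 →
        Extends r.1 (g.1 * h.1) := by
      intro g
      rw [hforall fun h => Extends (e p).1 (α g).1 → Extends (e q).1 h →
        Extends (e r).1 ((α g).1 * h)]
      refine forall_congr' fun h => ?_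
      have hr := he r (g * h)
      rw [map_mul] at hr
      rw [he p g, he q h]
      exact imp_congr_right fun _ => imp_congr_right fun _ => hr.symm
    simp only [this]
    exact ⟨fun h g hg k hk => h ⟨g, hg⟩ ⟨k, hk⟩, fun h g k => h g.1 g.2 k.1 k.2⟩

/-! ### From isomorphisms of coset structures to topological isomorphisms -/

/-- The idempotents among the restrictions are the identity maps. -/
theorem restr_eq_of_subComp_self {g : Equiv.Perm ℕ} {K : Finset ℕ}
    (h : SubComp (restr g K) (restr g K) (restr g K)) : restr g K = restr 1 K := by
  refine Finset.image_congr fun x hx => ?_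
  obtain ⟨y, hxy, hyz⟩ := h x (g x) (mem_restr.2 ⟨hx, rfl⟩)
  obtain ⟨-, rfl⟩ := mem_restr.1 hxy
  exact Prod.ext rfl (g.injective (mem_restr.1 hyz).2)

theorem subComp_restr (g h : Equiv.Perm ℕ) (K : Finset ℕ) :
    SubComp (restr g (K.image h)) (restr h K) (restr (g * h) K) := by
  intro x z hxz
  obtain ⟨hx, rfl⟩ := mem_restr.1 hxz
  exact ⟨h x, mem_restr.2 ⟨hx, rfl⟩, mem_restr.2 ⟨Finset.mem_image_of_mem h hx, rfl⟩⟩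

theorem restr_mem_restrictions {G : Subgroup (Equiv.Perm ℕ)} {g : Equiv.Perm ℕ} (hg : g ∈ G)
    {K : Finset ℕ} (hK : acl G K = K) : restr g K ∈ restrictions G := ⟨K, hK, g, hg, rfl⟩

section Reconstruction

variable {G H : ClosedSubgroup (Equiv.Perm ℕ)}
  (Φ : restrictions G.toSubgroup ≃[cosetLanguage] restrictions H.toSubgroup)

/-- The isomorphism `Φ` maps some restriction of `g` to a partial map that is defined on `s`. -/
theorem exists_restriction_defined_on (hH : IsOligomorphic H.toSubgroup) {g : Equiv.Perm ℕ}
    (hg : g ∈ G.toSubgroup) (s : Finset ℕ) :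
    ∃ (K : Finset ℕ) (hK : acl G.toSubgroup K = K),
      ∀ x ∈ s, ∃ y, (x, y) ∈ (Φ ⟨restr g K, restr_mem_restrictions hg hK⟩).1 := by
  obtain ⟨L, hL, hsL⟩ := hH.exists_aclClosed s.finite_toSet
  let i : restrictions H.toSubgroup := ⟨restr 1 L, restr_mem_restrictions (one_mem _) hL⟩
  obtain ⟨⟨_, K, hK, k, hk, rfl⟩, hei⟩ : ∃ e, Φ e = i := Φ.surjective i
  have hid : restr k K = restr 1 K := by
    refine restr_eq_of_subComp_self ?_
    have h := (map_subComp_iff Φ _ _ _).1 (show SubComp (Φ _).1 (Φ _).1 (Φ _).1 from by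
      rw [hei]
      simpa using subComp_restr 1 1 L)
    exact h
  refine ⟨K, hK, fun x hx => ?_⟩
  have hKg := acl_image_finset hg hK
  have h := (map_subComp_iff Φ ⟨_, restr_mem_restrictions (inv_mem hg) hKg⟩
    ⟨_, restr_mem_restrictions hg hK⟩ ⟨restr k K, restr_mem_restrictions hk hK⟩).2 (by
      have := subComp_restr g⁻¹ g K
      rwa [inv_mul_cancel, ← hid] at this)
  rw [hei] at h
  obtain ⟨y, hy, -⟩ := h x x (mem_restr.2 ⟨hsL hx, rfl⟩)
  exact ⟨y, hy⟩

/-- The images under `Φ` of the restrictions of a fixed `g ∈ G` are compatible with each other,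
since they have upper bounds. -/
theorem eq_of_mem_image_restriction (hG : IsOligomorphic G.toSubgroup) {g : Equiv.Perm ℕ}
    (hg : g ∈ G.toSubgroup) {p q : restrictions G.toSubgroup} (hp : Extends p.1 g)
    (hq : Extends q.1 g) {x y z : ℕ} (hy : (x, y) ∈ (Φ p).1) (hz : (x, z) ∈ (Φ q).1) : y = z := by
  obtain ⟨K, hK, hKpq⟩ := hG.exists_aclClosed
    ((p.1 ∪ q.1).image Prod.fst).finite_toSet
  have hsub : ∀ r : restrictions G.toSubgroup, r.1 ⊆ p.1 ∪ q.1 → Extends r.1 g →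
      (Φ r).1 ⊆ (Φ ⟨restr g K, restr_mem_restrictions hg hK⟩).1 := by
    intro r hr hrg
    rw [map_le_iff]
    rintro ⟨a, b⟩ hab
    exact mem_restr.2 ⟨hKpq (Finset.mem_coe.2 (Finset.mem_image_of_mem Prod.fst (hr hab))),
      hrg a b hab⟩
  have h1 := hsub p Finset.subset_union_left hp hy
  have h2 := hsub q Finset.subset_union_right hq hz
  obtain ⟨L, -, h, -, hL⟩ := (Φ ⟨restr g K, restr_mem_restrictions hg hK⟩).2
  rw [hL, mem_restr] at h1 h2
  exact h1.2.symm.trans h2.2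

/-- The union of the images under `Φ` of the restrictions of `g` is a member of `H`. -/
theorem exists_hom_extends (hG : IsOligomorphic G.toSubgroup) (hH : IsOligomorphic H.toSubgroup) :
    ∃ F : G.toSubgroup →* H.toSubgroup,
      ∀ (g : G.toSubgroup) (p : restrictions G.toSubgroup), Extends p.1 g.1 →
        Extends (Φ p).1 (F g).1 := by
  have hex : ∀ (g : G.toSubgroup) (x : ℕ), ∃ y, ∀ p : restrictions G.toSubgroup,
      Extends p.1 g.1 → ∀ z, (x, z) ∈ (Φ p).1 → y = z := by
    intro g x
    obtain ⟨K, hK, hx⟩ := exists_restriction_defined_on Φ hH g.2 {x}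
    obtain ⟨y, hy⟩ := hx x (Finset.mem_singleton_self x)
    exact ⟨y, fun p hp z hz => eq_of_mem_image_restriction Φ hG g.2
      (extends_restr.2 fun _ _ => rfl) hp hy hz⟩
  choose F hF using hex
  have hmul : ∀ g h x, F (g * h) x = F g (F h x) := by
    intro g h x
    obtain ⟨K, hK, hx⟩ := exists_restriction_defined_on Φ hH (g * h).2 {x}
    obtain ⟨z, hz⟩ := hx x (Finset.mem_singleton_self x)
    have hKh := acl_image_finset h.2 hK
    obtain ⟨y, hxy, hyz⟩ := (map_subComp_iff Φ ⟨_, restr_mem_restrictions g.2 hKh⟩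
      ⟨_, restr_mem_restrictions h.2 hK⟩ ⟨_, restr_mem_restrictions (g * h).2 hK⟩).2
      (subComp_restr g.1 h.1 K) x z hz
    rw [hF h x _ (extends_restr.2 fun _ _ => rfl) y hxy,
      hF g y _ (extends_restr.2 fun _ _ => rfl) z hyz,
      hF (g * h) x _ (extends_restr.2 fun _ _ => rfl) z hz]
  have hone : ∀ x, F 1 x = x := by
    intro x
    obtain ⟨K, hK, hx⟩ := exists_restriction_defined_on Φ hH (one_mem G.toSubgroup) {x}
    obtain ⟨z, hz⟩ := hx x (Finset.mem_singleton_self x)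
    have hidem := (map_subComp_iff Φ ⟨_, restr_mem_restrictions (one_mem G.toSubgroup) hK⟩
      ⟨_, restr_mem_restrictions (one_mem G.toSubgroup) hK⟩
      ⟨_, restr_mem_restrictions (one_mem G.toSubgroup) hK⟩).2 (by
        simpa using subComp_restr 1 1 K)
    obtain ⟨L, -, h, -, hL⟩ := (Φ ⟨_, restr_mem_restrictions (one_mem G.toSubgroup) hK⟩).2
    rw [hF 1 x _ (extends_restr.2 fun _ _ => rfl) z hz]
    rw [hL] at hidem hz
    rw [restr_eq_of_subComp_self hidem] at hz
    exact (mem_restr.1 hz).2.symm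
  let σ : G.toSubgroup → Equiv.Perm ℕ := fun g =>
    { toFun := F g
      invFun := F g⁻¹
      left_inv := fun x => by rw [← hmul, inv_mul_cancel, hone]
      right_inv := fun x => by rw [← hmul, mul_inv_cancel, hone] }
  have hσ : ∀ g, σ g ∈ H.toSubgroup := by
    intro g
    refine mem_of_forall_finset H fun s => ?_
    obtain ⟨K, hK, hx⟩ := exists_restriction_defined_on Φ hH g.2 s
    obtain ⟨L, -, h, hh, hL⟩ := (Φ ⟨_, restr_mem_restrictions g.2 hK⟩).2
    refine ⟨h, hh, fun x hxs => ?_⟩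
    obtain ⟨y, hy⟩ := hx x hxs
    change h x = F g x
    rw [hF g x _ (extends_restr.2 fun _ _ => rfl) y hy]
    rw [hL, mem_restr] at hy
    exact hy.2
  refine ⟨{ toFun := fun g => ⟨σ g, hσ g⟩, map_one' := ?_, map_mul' := fun g h => ?_ }, ?_⟩
  · exact Subtype.ext (Equiv.ext hone)
  · exact Subtype.ext (Equiv.ext (hmul g h))
  · exact fun g p hp x y hxy => hF g x p hp y hxy

theorem continuous_of_extends (hH : IsOligomorphic H.toSubgroup)
    {F : G.toSubgroup →* H.toSubgroup}
    (hF : ∀ (g : G.toSubgroup) (p : restrictions G.toSubgroup), Extends p.1 g.1 →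
      Extends (Φ p).1 (F g).1) : Continuous F := by
  refine continuous_induced_rng.2 (continuous_induced_rng.2 (continuous_pi fun x => ?_))
  refine IsLocallyConstant.continuous ((IsLocallyConstant.iff_exists_open _).2 fun g => ?_)
  obtain ⟨K, hK, hx⟩ := exists_restriction_defined_on Φ hH g.2 {x}
  obtain ⟨y, hy⟩ := hx x (Finset.mem_singleton_self x)
  refine ⟨Subtype.val ⁻¹' {k : Equiv.Perm ℕ | ∀ a ∈ K, k a = g.1 a},
    (isOpen_agree K g.1).preimage continuous_subtype_val, fun _ _ => rfl, fun k hk => ?_⟩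
  exact (hF k _ (extends_restr.2 hk) x y hy).trans
    (hF g _ (extends_restr.2 fun _ _ => rfl) x y hy).symm

theorem leftInverse_of_extends (hG : IsOligomorphic G.toSubgroup)
    {F : G.toSubgroup →* H.toSubgroup} {F' : H.toSubgroup →* G.toSubgroup}
    (hF : ∀ (g : G.toSubgroup) (p : restrictions G.toSubgroup), Extends p.1 g.1 →
      Extends (Φ p).1 (F g).1)
    (hF' : ∀ (h : H.toSubgroup) (q : restrictions H.toSubgroup), Extends q.1 h.1 →
      Extends (Φ.symm q).1 (F' h).1) (g : G.toSubgroup) : F' (F g) = g := by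
  refine Subtype.ext (Equiv.ext fun x => ?_)
  obtain ⟨K, hK, hxK⟩ := hG.exists_aclClosed (Set.finite_singleton x)
  have h := hF' _ _ (hF g ⟨_, restr_mem_restrictions g.2 hK⟩ (extends_restr.2 fun _ _ => rfl))
  rw [FirstOrder.Language.Equiv.symm_apply_apply] at h
  exact extends_restr.1 h x (hxK rfl)

theorem topIso_of_restrictions_equiv (hG : IsOligomorphic G.toSubgroup)
    (hH : IsOligomorphic H.toSubgroup)
    (Φ : restrictions G.toSubgroup ≃[cosetLanguage] restrictions H.toSubgroup) : TopIso G H := by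
  obtain ⟨F, hF⟩ := exists_hom_extends Φ hG hH
  obtain ⟨F', hF'⟩ := exists_hom_extends Φ.symm hH hG
  have hleft := leftInverse_of_extends Φ hG hF hF'
  have hright := leftInverse_of_extends Φ.symm hH hF' (F' := F) (by simpa using hF)
  exact ⟨{
    toFun := F
    invFun := F'
    left_inv := hleft
    right_inv := hright
    map_mul' := map_mul F
    continuous_toFun := continuous_of_extends Φ hH hF
    continuous_invFun := continuous_of_extends Φ.symm hG hF' }⟩

end Reconstruction

/-! ### The complete theory as a Borel invariant -/

theorem topIso_iff {G H : ClosedSubgroup (Equiv.Perm ℕ)} (hG : G ∈ autOmegaCatWEI)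
    (hH : H ∈ autOmegaCatWEI) : TopIso G H ↔
      (restrictions G.toSubgroup ≅[cosetLanguage] restrictions H.toSubgroup) := by
  rw [autOmegaCatWEI_eq] at hG hH
  constructor
  · intro h
    obtain ⟨e⟩ := nonempty_restrictions_equiv_of_topIso hG.2 hH.2 h
    exact StrongHomClass.elementarilyEquivalent e
  · intro h
    obtain ⟨K, hK, -⟩ := hG.1.exists_aclClosed Set.finite_empty
    have : Nonempty (restrictions G.toSubgroup) :=
      ⟨⟨_, restr_mem_restrictions (one_mem _) hK⟩⟩
    obtain ⟨e, -⟩ := exists_equiv_of_sameType h (isAtomic_restrictions hG.1)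
      (isAtomic_restrictions hH.1) (sameType_elim0 h)
    exact topIso_of_restrictions_equiv hG.1 hH.1 e

theorem measurableSet_mem_restrictions (p : Finset (ℕ × ℕ)) : MeasurableSet
    {G : ClosedSubgroup (Equiv.Perm ℕ) | p ∈ restrictions G.toSubgroup} := by
  refine measurableSet_exists fun K => (measurableSet_acl_eq K).inter
    (measurableSet_exists_mem K (fun G g h hgh hg => ?_) fun g => MeasurableSet.const _)
  rw [hg]
  exact Finset.image_congr fun x hx => by rw [hgh x hx]

/-- By induction on formulas, with parameters from the fixed countable set that contains all the
structures `restrictions G`. -/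
theorem measurableSet_realize {n : ℕ} (φ : cosetLanguage.BoundedFormula Empty n)
    (x : Fin n → Finset (ℕ × ℕ)) : MeasurableSet {G : ClosedSubgroup (Equiv.Perm ℕ) |
      ∃ h : ∀ i, x i ∈ restrictions G.toSubgroup,
        φ.Realize (M := restrictions G.toSubgroup) Empty.elim fun i => ⟨x i, h i⟩} := by
  have hdom : ∀ {n : ℕ} (x : Fin n → Finset (ℕ × ℕ)), MeasurableSet
      {G : ClosedSubgroup (Equiv.Perm ℕ) | ∀ i, x i ∈ restrictions G.toSubgroup} := fun x =>
    measurableSet_forall fun i => measurableSet_mem_restrictions (x i)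
  have hterm : ∀ {n : ℕ} (t : cosetLanguage.Term (Empty ⊕ Fin n)),
      ∃ i, t = Term.var (Sum.inr i) := by
    intro n t
    rcases t with (a | i) | f
    · exact a.elim
    · exact ⟨i, rfl⟩
    · rename_i f _
      exact f.elim
  induction φ with
  | falsum =>
    convert! MeasurableSet.empty using 1
    ext G
    simp [BoundedFormula.Realize]
  | equal t₁ t₂ =>
    obtain ⟨i, rfl⟩ := hterm t₁
    obtain ⟨j, rfl⟩ := hterm t₂
    convert! (hdom x).inter (MeasurableSet.const (x i = x j)) using 1
    ext G
    simp [BoundedFormula.Realize]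
  | rel R ts =>
    choose i hi using fun k => hterm (ts k)
    obtain rfl : ts = fun k => Term.var (Sum.inr (i k)) := funext hi
    cases R with
    | le =>
      convert! (hdom x).inter (MeasurableSet.const (x (i 0) ⊆ x (i 1))) using 1
      ext G
      exact ⟨fun ⟨h, H⟩ => ⟨h, H⟩, fun ⟨h, H⟩ => ⟨h, H⟩⟩
    | mul =>
      convert! (hdom x).inter (MeasurableSet.const (SubComp (x (i 0)) (x (i 1)) (x (i 2)))) using 1
      ext G
      exact ⟨fun ⟨h, H⟩ => ⟨h, H⟩, fun ⟨h, H⟩ => ⟨h, H⟩⟩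
  | imp φ ψ ihφ ihψ =>
    convert! (hdom x).inter (measurableSet_imp (ihφ x) (ihψ x)) using 1
    ext G
    simp only [Set.mem_ofPred_eq, Set.mem_inter_iff, BoundedFormula.realize_imp]
    exact ⟨fun ⟨h, H⟩ => ⟨h, fun ⟨h', H'⟩ => ⟨h, H H'⟩⟩,
      fun ⟨h, H⟩ => ⟨h, fun H' => (H ⟨h, H'⟩).2⟩⟩
  | all φ ih =>
    convert! (hdom x).inter (measurableSet_forall fun y : Finset (ℕ × ℕ) =>
      measurableSet_imp (measurableSet_mem_restrictions y) (ih (Fin.snoc x y))) using 1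
    ext G
    simp only [Set.mem_ofPred_eq, Set.mem_inter_iff, BoundedFormula.realize_all]
    have hsnoc : ∀ (y : Finset (ℕ × ℕ)) (hy : y ∈ restrictions G.toSubgroup)
        (h : ∀ i, x i ∈ restrictions G.toSubgroup)
        (h' : ∀ i, (Fin.snoc x y : Fin (_ + 1) → Finset (ℕ × ℕ)) i ∈ restrictions G.toSubgroup),
        (fun i => ⟨(Fin.snoc x y : Fin (_ + 1) → Finset (ℕ × ℕ)) i, h' i⟩ :
          Fin (_ + 1) → restrictions G.toSubgroup) = Fin.snoc (fun i => ⟨x i, h i⟩) ⟨y, hy⟩ := by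
      intro y hy h h'
      funext i
      refine Fin.lastCases ?_ (fun i => ?_) i <;> simp
    constructor
    · rintro ⟨h, H⟩
      refine ⟨h, fun y hy => ?_⟩
      have h' : ∀ i, (Fin.snoc x y : Fin (_ + 1) → Finset (ℕ × ℕ)) i ∈
          restrictions G.toSubgroup := by
        intro i
        refine Fin.lastCases ?_ (fun i => ?_) i
        · simpa using hy
        · simpa using h i
      refine ⟨h', ?_⟩
      rw [hsnoc y hy h h']
      exact H ⟨y, hy⟩
    · rintro ⟨h, H⟩
      refine ⟨h, fun y => ?_⟩
      obtain ⟨h', H'⟩ := H y.1 y.2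
      rwa [hsnoc y.1 y.2 h h'] at H'

theorem measurableSet_realize_sentence (φ : cosetLanguage.Sentence) : MeasurableSet
    {G : ClosedSubgroup (Equiv.Perm ℕ) | restrictions G.toSubgroup ⊨ φ} := by
  convert! measurableSet_realize φ Fin.elim0 using 1
  ext G
  simp only [Set.mem_ofPred_eq, Sentence.Realize, Formula.Realize]
  constructor
  · intro h
    refine ⟨fun i => i.elim0, ?_⟩
    convert! h using 1
  · rintro ⟨h', h⟩
    convert! h using 1

theorem smooth_topIso : Smooth (fun G H : autOmegaCatWEI => TopIso G.1 H.1) := by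
  classical
  have := countable_cosetLanguage
  have : Countable cosetLanguage.Sentence := countable_formula Empty
  obtain ⟨r, hr⟩ := MeasureTheory.exists_measurableEmbedding_real (cosetLanguage.Sentence → Bool)
  let T : ClosedSubgroup (Equiv.Perm ℕ) → cosetLanguage.Sentence → Bool := fun G φ =>
    decide (restrictions G.toSubgroup ⊨ φ)
  have hT : Measurable T := measurable_pi_lambda _ fun φ => by
    refine measurable_to_bool ?_
    convert! measurableSet_realize_sentence φ using 1
    ext G
    simp [T]
  refine ⟨fun G => r (T G.1), hr.measurable.comp (hT.comp measurable_subtype_coe), fun G H => ?_⟩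
  change TopIso G.1 H.1 ↔ r (T G.1) = r (T H.1)
  rw [topIso_iff G.2 H.2, elementarilyEquivalent_iff, hr.injective.eq_iff, funext_iff]
  exact forall_congr' fun φ => by simp [T]

end OligoIso

theorem theorem1p1 :
    MeasurableSet OligoIso.oligomorphicGroups ∧
    OligoIso.autOmegaCatWEI ⊆ OligoIso.oligomorphicGroups ∧
    MeasurableSet OligoIso.autOmegaCatWEI ∧
    OligoIso.Smooth (fun G H : OligoIso.autOmegaCatWEI => OligoIso.TopIso G.1 H.1) := by
  refine ⟨OligoIso.measurableSet_oligomorphicGroups, ?_, OligoIso.measurableSet_autOmegaCatWEI,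
    OligoIso.smooth_topIso⟩
  rw [OligoIso.autOmegaCatWEI_eq]
  exact fun G hG => hG.1
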